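/- Let $d\ge 3$, $r\ge 2$ and $n_1,\dots,n_d\ge r^2$; mode numbers are read modulo $d$. For cores $\mathcal Q_k\in\mathbb C^{n_k\times r\times r}$ with slices $Q_k^{(a)}\in\mathbb C^{r\times r}$ let $T\in\mathbb C^{n_1\times\cdots\times n_d}$ be the tensor $T(x_1,\dots,x_d)=\operatorname{tr}\bigl(Q_1^{(x_1)}Q_2^{(x_2)}\cdots Q_d^{(x_d)}\bigr)$. Suppose that the entries of all cores are drawn from a joint probability law $\mu$ on $\prod_k\mathbb C^{n_k\times r\times r}$ that is absolutely continuous with respect to Lebesgue measure. *Notation.* The columns of $r^2$-column matrices are numbered by pairs $(i,j)\in[r]^2$, $(i,j)$ being number $(i-1)r+j$. For a core $\mathcal Q$ put $Q_{\langle1\rangle}(a,(i,j))=Q^{(a)}_{ij}$ and $Q_{[1]}(a,(i,j))=Q^{(a)}_{ji}$. For an $r^2\times r^2$ matrix, $\Pi(X)_{(j_2,j_1),(k_2,k_1)}=X_{(j_1,j_2),(k_1,k_2)}$. $A^\dagger$ is the Moore–Penrose inverse. For $\alpha\in[n_2]\times\cdots\times[n_{d-1}]$ and $S\subseteq[n_d]$,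 $T(:,\alpha,S)$ is the $n_1\times|S|$ matrix of the entries $T(a,\alpha,b)$, $a\in[n_1]$, $b\in S$. For $\gamma\in[n_1]\times\cdots\times[n_d]$, $k\in[d]$ and $G\subseteq[n_k]$, $T_k(\gamma,G)$ is the $n_{k+1}\times|G|$ matrix of the entries of $T$ whose index in mode $k+1$ is the row number, whose index in mode $k$ is the column number in $G$, and whose index in any other mode $j$ is $\gamma_j$. *Index choices.* Choose $\alpha,\beta,\alpha',\beta'\in[n_2]\times\cdots\times[n_{d-1}]$, sets $S,S'\subseteq[n_d]$ and $G_k\subseteq[n_k]$ ($k\in[d]$) with $r^2$ elements each, and $\gamma\in[n_1]\times\cdots\times[n_d]$. The choice is admissible if $\alpha\ne\beta$, $\alpha'\ne\beta'$ and the following holds: if $m$ and $m'$ are the largest modes with $\alpha_m\neq\beta_m$ and $\alpha'_{m'}\ne\beta'_{m'}$, then $m\neq m'$ or $\{\alpha_{\le m},\beta_{\le m}\}\ne\{\alpha'_{\le m},\beta'_{\le m}\}$, where $\alpha_{\le m}=(\alpha_2,\dots,\alpha_m)$. (For $d=3$ the last condition says $\{\alpha,\beta\}\ne\{\alpha',\beta'\}$.)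 Let $\Delta$ be the set of positions of the entries in $T(:,\alpha,S)$, $T(:,\beta,S)$, $T(:,\alpha',S')$, $T(:,\beta',S')$ and $T_k(\gamma,G_k)$, $k\in[d]$. *The algorithm (BLOSTR)* receives only $r$, an admissible choice and the entries of $T$ at $\Delta$, and performs these steps in exact arithmetic. 1. Find $E,E'\in\mathbb C^{n_1\times r^2}$ whose columns are bases of eigenvectors for the nonzero spectrum of $T(:,\alpha,S)\,T(:,\beta,S)^\dagger$ and $T(:,\alpha',S')\,T(:,\beta',S')^\dagger$, respectively, arranged so that, for $r$ distinct nonzero eigenvalues $\lambda_1,\dots,\lambda_r$ in any order, column $(j,k)$ belongs to $\lambda_k$. 2. Put $F=E^\dagger E'$ and $F^{(j,k)}=\bigl(F_{(a,j),(b,k)}\bigr)_{a,b\in[r]}$. 3. Put $\hat K_1=I_r$ and $\hat K_\ell=F^{(1,1)}(F^{(\ell,1)})^{-1}$ for $2\le\ell\le r$. 4. Define $\hat{\mathcal Q}_1$ by $\hat Q_{1\langle1\rangle}=E\,\bigl(\Pi(\operatorname{blockdiag}(\hat K_1,\dots,\hat K_r))\bigr)^{-1}$. 5. For $k=2,\dots,d$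 (one step each) define $\hat{\mathcal Q}_k$ by $$\hat Q_{k\langle1\rangle}=T_{k-1}(\gamma,G_{k-1})\Bigl(\bigl(I_r\otimes(\hat Q_1^{(\gamma_1)}\cdots\hat Q_{k-2}^{(\gamma_{k-2})})\bigr)\,\hat Q_{(k-1)[1]}^{\top}(:,G_{k-1})\Bigr)^\dagger ,$$ the product in the inner parentheses being $I_r$ for $k=2$. Then admissible choices exist, and for each of them $|\Delta|\le 5r^2\sum_{k}n_k$, so that the algorithm uses only $O(r^2\sum_k n_k)$ entries of $T$. Moreover, with probability one, for every admissible choice and every choice of the eigenbases in step 1, all steps of the algorithm can be carried out (in particular such eigenbases exist and all matrices to be inverted are invertible), it stops after exactly $d+3$ steps, and its output recovers the cores up to gauge: there are $L_1,\dots,L_d\in GL(r,\mathbb C)$ with $\hat Q_k^{(a)}=L_k^{-1}Q_k^{(a)}L_{k+1}$ for all $k\in[d]$ and $a\in[n_k]$, where $L_{d+1}=L_1$. -/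

import Mathlib

open MeasureTheory
open scoped Kronecker

noncomputable section

namespace TensorRing

/-- Multi-indices of an order-`d` tensor with mode sizes `n k`. Modes are numbered `0, …, d - 1`,
and addition on `Fin d` is cyclic. -/
abbrev Index {d : ℕ} (n : Fin d → ℕ) : Type := (k : Fin d) → Fin (n k)

/-- Families of `d` cores, the `k`-th one of size `n k × r × r`. `Q k a` is the `a`-th slice. -/
abbrev Cores {d : ℕ} (n : Fin d → ℕ) (r : ℕ) : Type :=
  (k : Fin d) → Fin (n k) → Fin r → Fin r → ℂ

/-- The slice `Q_k^{(a)}` as an `r × r` matrix. -/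
def coreSlice {d r : ℕ} {n : Fin d → ℕ} (Q : Cores n r) (k : Fin d) (a : Fin (n k)) :
    Matrix (Fin r) (Fin r) ℂ :=
  Matrix.of (Q k a)

/-- The tensor with given cores: `T(x) = tr (Q_0^{(x_0)} Q_1^{(x_1)} ⋯ Q_{d-1}^{(x_{d-1})})`. -/
def ringTensor {d r : ℕ} {n : Fin d → ℕ} (Q : Cores n r) (x : Index n) : ℂ :=
  Matrix.trace (List.ofFn fun k : Fin d => coreSlice Q k (x k)).prod

/-- Gauge equivalence: `Q'_k^{(a)} = L_k⁻¹ Q_k^{(a)} L_{k+1}` for invertible `L_k`, with `k + 1`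
taken modulo `d`. -/
def GaugeEquiv {d r : ℕ} [NeZero d] {n : Fin d → ℕ} (Q Q' : Cores n r) : Prop :=
  ∃ L : Fin d → GL (Fin r) ℂ, ∀ (k : Fin d) (a : Fin (n k)),
    coreSlice Q' k a = ((L k)⁻¹ : GL (Fin r) ℂ).val * coreSlice Q k a * (L (k + 1)).val

/-- The unfolding `A_{⟨1⟩}` of an `m × r × r` array. The pair `(i, j)` stands for the column
number `(i - 1) r + j`. -/
def unfoldAngle {m r : ℕ} (A : Fin m → Fin r → Fin r → ℂ) :
    Matrix (Fin m) (Fin r × Fin r) ℂ :=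
  Matrix.of fun a ij => A a ij.1 ij.2

/-- The unfolding `A_{[1]}` of an `m × r × r` array, with columns numbered in the same way. -/
def unfoldBracket {m r : ℕ} (A : Fin m → Fin r → Fin r → ℂ) :
    Matrix (Fin m) (Fin r × Fin r) ℂ :=
  Matrix.of fun a ij => A a ij.2 ij.1

/-- The inverse operation of `unfoldAngle`. -/
def reshape {m r : ℕ} (Y : Matrix (Fin m) (Fin r × Fin r) ℂ) : Fin m → Fin r → Fin r → ℂ :=
  fun a i j => Y a (i, j)

/-- The block-diagonal `r² × r²` matrix with diagonal blocks `K 0, …, K (r - 1)`. -/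
def blockDiag {r : ℕ} (K : Fin r → Matrix (Fin r) (Fin r) ℂ) :
    Matrix (Fin r × Fin r) (Fin r × Fin r) ℂ :=
  Matrix.of fun x y => if x.1 = y.1 then K x.1 x.2 y.2 else 0

/-- The permutation operation `Π` on the rows and columns of an `r² × r²` matrix. -/
def permPi {r : ℕ} (X : Matrix (Fin r × Fin r) (Fin r × Fin r) ℂ) :
    Matrix (Fin r × Fin r) (Fin r × Fin r) ℂ :=
  X.submatrix Prod.swap Prod.swap

/-- The block `F^{(j,k)}`: rows `j, r + j, 2r + j, …` and columns `k, r + k, 2r + k, …` of `F`. -/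
def subBlock {r : ℕ} (F : Matrix (Fin r × Fin r) (Fin r × Fin r) ℂ) (j k : Fin r) :
    Matrix (Fin r) (Fin r) ℂ :=
  Matrix.of fun a b => F (a, j) (b, k)

/-- `X` is the Moore–Penrose inverse of `A` (the four Penrose equations). -/
def IsMoorePenrose {p q : Type} [Fintype p] [Fintype q] (A : Matrix p q ℂ) (X : Matrix q p ℂ) :
    Prop :=
  A * X * A = A ∧ X * A * X = X ∧ (A * X).conjTranspose = A * X ∧
    (X * A).conjTranspose = X * A

/-- The columns of `E` are eigenvectors of `A` for its nonzero spectrum, grouped as the algorithm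
wants them: the nonzero eigenvalues are `r` distinct numbers `lam k`, taken in some order, and
column `(j, k)` is the `j`-th vector of a basis of the eigenspace of `lam k`. -/
def IsEigenbasis {m r : ℕ} (A : Matrix (Fin m) (Fin m) ℂ)
    (E : Matrix (Fin m) (Fin r × Fin r) ℂ) : Prop :=
  ∃ lam : Fin r → ℂ, Function.Injective lam ∧ (∀ k, lam k ≠ 0) ∧
    (∀ j k, A.mulVec (E.col (j, k)) = lam k • E.col (j, k)) ∧
    LinearIndependent ℂ E.col ∧
    ∀ (z : ℂ) (v : Fin m → ℂ), z ≠ 0 → A.mulVec v = z • v →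
      v ∈ Submodule.span ℂ (Set.range E.col)

/-- The last mode. -/
def lastMode (d : ℕ) [NeZero d] : Fin d := ⟨d - 1, Nat.sub_lt (NeZero.pos d) Nat.one_pos⟩

/-- The middle modes: all modes but the first and the last one. -/
def IsMid {d : ℕ} [NeZero d] (k : Fin d) : Prop := k ≠ 0 ∧ k ≠ lastMode d

/-- The multi-index with entry `a` in mode `i`, entry `b` in mode `j`, and the entries of `x` in
all other modes. -/
def place {d : ℕ} {n : Fin d → ℕ} (x : Index n) (i j : Fin d) (a : Fin (n i)) (b : Fin (n j)) :
    Index n :=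
  Function.update (Function.update x i a) j b

/-- The positions of the entries of a matrix slice: mode `i` is free, mode `j` runs through `S`,
and all other modes are fixed to the entries of `x`. -/
def slicePositions {d : ℕ} {n : Fin d → ℕ} (x : Index n) (i j : Fin d) (S : Finset (Fin (n j))) :
    Finset (Index n) :=
  ((Finset.univ : Finset (Fin (n i))) ×ˢ S).image fun ab => place x i j ab.1 ab.2

/-- `m` is the largest middle mode in which `x` and `y` differ. -/
def IsLastDiff {d : ℕ} [NeZero d] {n : Fin d → ℕ} (x y : Index n) (m : Fin d) : Prop :=
  IsMid m ∧ x m ≠ y m ∧ ∀ k, IsMid k → m < k → x k = y k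

/-- `x` and `y` agree in all middle modes up to `m`. -/
def AgreeUpTo {d : ℕ} [NeZero d] {n : Fin d → ℕ} (m : Fin d) (x y : Index n) : Prop :=
  ∀ k, IsMid k → k ≤ m → x k = y k

/-- The index choices that the algorithm works with: two probe pairs `(α, β)` and `(α', β')`, of
which only the middle entries are used, the column sets `S` and `S'` of the two probes, the
multi-index `γ`, and the column sets `G k` for the sequential solves. -/
structure Choice {d : ℕ} [NeZero d] (n : Fin d → ℕ) where
  α : Index n
  β : Index n
  α' : Index n
  β' : Index n
  S : Finset (Fin (n (lastMode d)))
  S' : Finset (Fin (n (lastMode d)))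
  γ : Index n
  G : (k : Fin d) → Finset (Fin (n k))

namespace Choice

variable {d : ℕ} [NeZero d] {n : Fin d → ℕ}

/-- All column sets have `r²` elements, the middle parts satisfy `α ≠ β` and `α' ≠ β'`, and the
pairs `{α, β}` and `{α', β'}` are different, even after the common final entries of `α` and `β`,
and those of `α'` and `β'`, have been deleted. (Those entries cancel in
`R^α (R^β)⁻¹`, where `R^α` is the product of the slices that `α` selects in the middle modes.) -/
def Admissible (P : Choice n) (r : ℕ) : Prop :=
  P.S.card = r ^ 2 ∧ P.S'.card = r ^ 2 ∧ (∀ k, (P.G k).card = r ^ 2) ∧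
    ∃ m m' : Fin d, IsLastDiff P.α P.β m ∧ IsLastDiff P.α' P.β' m' ∧
      (m = m' → ¬ (AgreeUpTo m P.α P.α' ∧ AgreeUpTo m P.β P.β') ∧
        ¬ (AgreeUpTo m P.α P.β' ∧ AgreeUpTo m P.β P.α'))

/-- The set `Δ` of positions of the observed entries. -/
def Δ (P : Choice n) : Finset (Index n) :=
  (slicePositions P.α 0 (lastMode d) P.S ∪ slicePositions P.β 0 (lastMode d) P.S) ∪
  (slicePositions P.α' 0 (lastMode d) P.S' ∪ slicePositions P.β' 0 (lastMode d) P.S') ∪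
  Finset.univ.biUnion fun k : Fin d => slicePositions P.γ (k + 1) k (P.G k)

end Choice

/-- Reading an observed entry. The default value is never used by the algorithm, which reads only
positions in `D`. -/
def readEntry {d : ℕ} {n : Fin d → ℕ} {D : Finset (Index n)} (obs : D → ℂ) (x : Index n) : ℂ :=
  if h : x ∈ D then obs ⟨x, h⟩ else 0

/-- The matrix slice with rows in mode `i`, columns in mode `j` restricted to `S`, and all other
modes fixed to the entries of `x`. -/
def obsSlice {d : ℕ} {n : Fin d → ℕ} {D : Finset (Index n)} (obs : D → ℂ)
    (x : Index n) (i j : Fin d) (S : Finset (Fin (n j))) : Matrix (Fin (n i)) S ℂ :=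
  Matrix.of fun a b => readEntry obs (place x i j a b.1)

/-- The states of the algorithm. In `cores m Q` the first `m` cores have been computed. -/
inductive State {d : ℕ} [NeZero d] (n : Fin d → ℕ) (r : ℕ) where
  | start : State n r
  | eigen (E E' : Matrix (Fin (n 0)) (Fin r × Fin r) ℂ) : State n r
  | blocks (E : Matrix (Fin (n 0)) (Fin r × Fin r) ℂ)
      (F : Matrix (Fin r × Fin r) (Fin r × Fin r) ℂ) : State n r
  | gauge (E : Matrix (Fin (n 0)) (Fin r × Fin r) ℂ)
      (K : Fin r → Matrix (Fin r) (Fin r) ℂ) : State n r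
  | cores (m : ℕ) (Q : Cores n r) : State n r

/-- One step of the algorithm, whose only input is the family `obs` of observed entries and the
index choice. The step relation is not deterministic, as the eigenbases may be chosen freely. A
step that inverts a matrix is possible only if that matrix is invertible. -/
inductive Step {d r : ℕ} [NeZero d] [NeZero r] {n : Fin d → ℕ} (P : Choice n) (obs : P.Δ → ℂ) :
    State n r → State n r → Prop
  /-- Eigenvectors of `T(:,α,S) T(:,β,S)†` and `T(:,α',S') T(:,β',S')†`. -/
  | probes (X : Matrix P.S (Fin (n 0)) ℂ) (X' : Matrix P.S' (Fin (n 0)) ℂ)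
      (E E' : Matrix (Fin (n 0)) (Fin r × Fin r) ℂ)
      (hX : IsMoorePenrose (obsSlice obs P.β 0 (lastMode d) P.S) X)
      (hX' : IsMoorePenrose (obsSlice obs P.β' 0 (lastMode d) P.S') X')
      (hE : IsEigenbasis (obsSlice obs P.α 0 (lastMode d) P.S * X) E)
      (hE' : IsEigenbasis (obsSlice obs P.α' 0 (lastMode d) P.S' * X') E') :
      Step P obs .start (.eigen E E')
  /-- `F = E† E'`. -/
  | compare (E E' : Matrix (Fin (n 0)) (Fin r × Fin r) ℂ)
      (Y : Matrix (Fin r × Fin r) (Fin (n 0)) ℂ) (hY : IsMoorePenrose E Y) :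
      Step P obs (.eigen E E') (.blocks E (Y * E'))
  /-- `K_1 = I` and `K_ℓ = F^{(1,1)} (F^{(ℓ,1)})⁻¹` for the other `ℓ`. -/
  | fixGauge (E : Matrix (Fin (n 0)) (Fin r × Fin r) ℂ)
      (F : Matrix (Fin r × Fin r) (Fin r × Fin r) ℂ)
      (hF : ∀ l : Fin r, l ≠ 0 → IsUnit (subBlock F l 0)) :
      Step P obs (.blocks E F)
        (.gauge E fun l => if l = 0 then 1 else subBlock F 0 0 * (subBlock F l 0)⁻¹)
  /-- The first core: its unfolding is `E Π(K)⁻¹`. -/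
  | firstCore (E : Matrix (Fin (n 0)) (Fin r × Fin r) ℂ)
      (K : Fin r → Matrix (Fin r) (Fin r) ℂ)
      (hK : IsUnit (permPi (blockDiag K))) :
      Step P obs (.gauge E K)
        (.cores 1 (Function.update (0 : Cores n r) 0 (reshape (E * (permPi (blockDiag K))⁻¹))))
  /-- The core of mode `m + 1`, from those of the modes `0, …, m`. -/
  | nextCore (m : ℕ) (h : m + 1 < d) (Q : Cores n r)
      (Z : Matrix (P.G ⟨m, Nat.lt_of_succ_lt h⟩) (Fin r × Fin r) ℂ)
      (hZ : IsMoorePenrose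
        (((1 : Matrix (Fin r) (Fin r) ℂ) ⊗ₖ
            ((List.ofFn fun k : Fin d => coreSlice Q k (P.γ k)).take m).prod) *
          (unfoldBracket (Q ⟨m, Nat.lt_of_succ_lt h⟩)).transpose.submatrix id Subtype.val) Z) :
      Step P obs (.cores (m + 1) Q)
        (.cores (m + 2) (Function.update Q ⟨m + 1, h⟩
          (reshape (obsSlice obs P.γ ⟨m + 1, h⟩ ⟨m, Nat.lt_of_succ_lt h⟩
            (P.G ⟨m, Nat.lt_of_succ_lt h⟩) * Z))))

/-- `RunsTo P obs N s`: some run of the algorithm is in state `s` after `N` steps. -/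
inductive RunsTo {d r : ℕ} [NeZero d] [NeZero r] {n : Fin d → ℕ} (P : Choice n) (obs : P.Δ → ℂ) :
    ℕ → State n r → Prop
  | init : RunsTo P obs 0 .start
  | next {N : ℕ} {s t : State n r} : RunsTo P obs N s → Step P obs s t → RunsTo P obs (N + 1) t

end TensorRing

end

open TensorRing

/-
The observed slice `T(:,x,S)` factors as `Q_⟨1⟩ (I ⊗ R^x) B_S`, where `R^x` is the product of the
middle slices that `x` selects and the outer factors have full rank `r²`. Hence
`T(:,α,S) T(:,β,S)†` is similar, on its range, to `I ⊗ N` with `N = R^α (R^β)⁻¹`, and an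
eigenbasis has the form `E = Q_⟨1⟩ (I ⊗ U) blockdiag(V_1, …, V_r)`, where the columns of `U` are
eigenvectors of `N` and the `V_k` are arbitrary invertible matrices. A second probe with
eigenvectors `U'` removes this ambiguity: block `(j, k)` of `F = E† E'` is
`(U⁻¹ U')_{jk} V_j⁻¹ V'_k`, so the first block column determines the `V_j` up to scalars and a
common factor as soon as no entry of `U⁻¹ U'` vanishes. The first core is then known up to gauge,
and each later core follows from a linear system with a unique solution.

What has to be generic is that `N` and `N'` have simple spectra and eigenbases in general
position. Both conditions are expressed by polynomials in the entries of the cores: the spectrum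
of `N` is simple when the Gram matrix `tr N^(i+j)` is invertible, and no entry of `U⁻¹ U'`
vanishes when the products `N^i N'^j` are linearly independent. A complex polynomial that is
nonzero at one point vanishes only on a null set, so one good family of cores suffices;
admissibility makes it possible to realize a given pair `(N, N')`, up to inverses and conjugation,
by cores with trivial slices except in at most two modes.
-/

open MeasureTheory
open scoped Kronecker Matrix

noncomputable section

namespace TensorRing

section NullSets

variable {E F : Type*} [NormedAddCommGroup E] [NormedSpace ℂ E] [NormedSpace ℝ E]
  [IsScalarTower ℝ ℂ E] [NormedAddCommGroup F] [NormedSpace ℂ F] [CompleteSpace F]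

theorem ae_apply_add_smul_ne_zero {f : E → F} (hf : Differentiable ℂ f) {x₀ : E} (h₀ : f x₀ ≠ 0)
    (x : E) : ∀ᵐ t : ℝ, f (x₀ + t • x) ≠ 0 := by
  have hanalytic : AnalyticOnNhd ℝ (fun t : ℝ => f (x₀ + (t : ℂ) • x)) Set.univ := fun t _ => by
    have hline : Differentiable ℂ fun z : ℂ => f (x₀ + z • x) := by fun_prop
    have hreal : AnalyticAt ℝ (fun z : ℂ => f (x₀ + z • x)) (t : ℂ) :=
      (hline.analyticAt (t : ℂ)).restrictScalars
    exact hreal.comp (Complex.ofRealCLM.analyticAt t)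
  have hcodiscrete := hanalytic.preimage_zero_mem_codiscrete (x := 0) (by simpa using h₀)
  have hae := ae_restrict_le_codiscreteWithin (μ := (volume : Measure ℝ)) MeasurableSet.univ
    hcodiscrete
  rw [Measure.restrict_univ] at hae
  filter_upwards [hae] with t ht
  have hsmul : (t : ℂ) • x = t • x := algebraMap_smul ℂ t x
  rwa [← hsmul]

-- Fubini: some dilation of the lines through `x₀` meets the zero set in a null set, and dilations
-- and translations preserve null sets.
theorem ae_ne_zero_of_differentiable [FiniteDimensional ℝ E] [MeasurableSpace E] [BorelSpace E]
    (μ : Measure E) [μ.IsAddHaarMeasure] {f : E → F} (hf : Differentiable ℂ f) {x₀ : E}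
    (h₀ : f x₀ ≠ 0) : ∀ᵐ x ∂μ, f x ≠ 0 := by
  have := FiniteDimensional.proper_real E
  have : SecondCountableTopology E := secondCountable_of_proper
  have hmeas : MeasurableSet {p : E × ℝ | f (x₀ + p.2 • p.1) ≠ 0} := by
    have hcont : Continuous fun p : E × ℝ => f (x₀ + p.2 • p.1) :=
      hf.continuous.comp (by fun_prop)
    exact (isOpen_ne_fun hcont continuous_const).measurableSet
  have hprod : ∀ᵐ p ∂μ.prod (volume : Measure ℝ), f (x₀ + p.2 • p.1) ≠ 0 :=
    (Measure.ae_prod_iff_ae_ae hmeas).2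
      (Filter.Eventually.of_forall fun x => ae_apply_add_smul_ne_zero hf h₀ x)
  have hswap : ∀ᵐ t : ℝ, ∀ᵐ x ∂μ, f (x₀ + t • x) ≠ 0 :=
    Measure.ae_ae_of_ae_prod
      ((Measure.measurePreserving_swap (μ := (volume : Measure ℝ))
        (ν := μ)).quasiMeasurePreserving.ae hprod)
  obtain ⟨t, ht, ht₀⟩ := (hswap.and (Measure.ae_ne volume (0 : ℝ))).exists
  have hdilate : ∀ᵐ x ∂μ, f (x₀ + x) ≠ 0 := by
    change μ ((fun x => t • x) ⁻¹' {y | ¬ f (x₀ + y) ≠ 0}) = 0 at ht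
    rw [Measure.addHaar_preimage_smul μ ht₀, mul_eq_zero] at ht
    refine ht.resolve_left (ENNReal.ofReal_pos.2 ?_).ne'
    positivity
  change μ ((fun x => x₀ + x) ⁻¹' {y | ¬ f y ≠ 0}) = 0 at hdilate
  rwa [measure_preimage_add] at hdilate

end NullSets

section Differentiability

attribute [local instance] Matrix.linftyOpNormedRing Matrix.linftyOpNormedAlgebra

variable {𝕜 E ι κ : Type*} [NontriviallyNormedField 𝕜] [NormedAddCommGroup E] [NormedSpace 𝕜 E]

theorem differentiable_matrix_iff [Finite κ] {M : E → Matrix ι κ 𝕜} :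
    Differentiable 𝕜 M ↔ ∀ i j, Differentiable 𝕜 fun x => M x i j :=
  have := Fintype.ofFinite κ
  (differentiable_pi (F' := fun _ => κ → 𝕜) (Φ := M)).trans
    (forall_congr' fun _ => differentiable_pi)

variable [Fintype ι] {M N : E → Matrix ι ι 𝕜}

theorem differentiable_trace (hM : Differentiable 𝕜 M) :
    Differentiable 𝕜 fun x => (M x).trace := by
  have hentry := differentiable_matrix_iff.1 hM
  simp only [Matrix.trace, Matrix.diag]
  fun_prop

theorem differentiable_matrix_mul (hM : Differentiable 𝕜 M) (hN : Differentiable 𝕜 N) :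
    Differentiable 𝕜 fun x => M x * N x := by
  classical
  fun_prop

variable [DecidableEq ι]

theorem differentiable_matrix_pow (hM : Differentiable 𝕜 M) (k : ℕ) :
    Differentiable 𝕜 fun x => M x ^ k := by
  fun_prop

theorem differentiable_ofFn_prod {d : ℕ} {M : Fin d → E → Matrix ι ι 𝕜}
    (hM : ∀ k, Differentiable 𝕜 (M k)) :
    Differentiable 𝕜 fun x => (List.ofFn fun k => M k x).prod := fun x => by
  simp only [List.ofFn_eq_map]
  exact (HasFDerivAt.list_prod' fun k _ => (hM k x).hasFDerivAt).differentiableAt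

theorem differentiable_det (hM : Differentiable 𝕜 M) : Differentiable 𝕜 fun x => (M x).det := by
  have hentry := differentiable_matrix_iff.1 hM
  simp only [Matrix.det_apply, Units.smul_def, zsmul_eq_mul]
  fun_prop

theorem differentiable_adjugate (hM : Differentiable 𝕜 M) :
    Differentiable 𝕜 fun x => (M x).adjugate := by
  have hentry := differentiable_matrix_iff.1 hM
  refine differentiable_matrix_iff.2 fun i j => ?_
  simp only [Matrix.adjugate_apply]
  refine differentiable_det (differentiable_matrix_iff.2 fun k l => ?_)
  by_cases hk : k = j
  · simp [hk]
  · simpa [Matrix.updateRow_ne hk] using hentry k l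

end Differentiability

section Eigenframe

variable {K ι : Type*} [Field K] [Fintype ι] [DecidableEq ι] {N : Matrix ι ι K} {U : GL ι K}
  {x : ι → K}

/-- The columns of `U` form a basis of eigenvectors of `N`, for the pairwise different eigenvalues
`x k`. -/
structure IsEigenframe (N : Matrix ι ι K) (U : GL ι K) (x : ι → K) : Prop where
  injective : Function.Injective x
  mul_eq : N * U.val = U.val * Matrix.diagonal x

namespace IsEigenframe

theorem pow_eq (h : IsEigenframe N U x) (k : ℕ) :
    N ^ k = U.val * Matrix.diagonal (x ^ k) * U⁻¹.val := by
  have hsemiconj : SemiconjBy U.val (Matrix.diagonal x) N := h.mul_eq.symm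
  rw [← Matrix.diagonal_pow, (hsemiconj.pow_right k).eq, Units.mul_inv_cancel_right]

theorem smul (h : IsEigenframe N U x) {c : K} (hc : c ≠ 0) : IsEigenframe (c • N) U (c • x) where
  injective := (mul_right_injective₀ hc).comp h.injective
  mul_eq := by rw [smul_mul_assoc, h.mul_eq, Matrix.diagonal_smul, mul_smul_comm]

theorem conj (h : IsEigenframe N U x) (V : GL ι K) :
    IsEigenframe (V.val * N * V⁻¹.val) (V * U) x where
  injective := h.injective
  mul_eq := by
    rw [Units.val_mul, mul_assoc, Units.inv_mul_cancel_left, mul_assoc, h.mul_eq, mul_assoc]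

theorem ne_zero {N : GL ι K} (h : IsEigenframe N.val U x) (k : ι) : x k ≠ 0 := by
  have hdiag : IsUnit (Matrix.diagonal x) := by
    rw [← Units.isUnit_units_mul U, ← h.mul_eq, ← Units.val_mul]
    exact (N * U).isUnit
  exact (Pi.isUnit_iff.1 (Matrix.isUnit_diagonal.1 hdiag) k).ne_zero

theorem inv {N : GL ι K} (h : IsEigenframe N.val U x) : IsEigenframe N⁻¹.val U x⁻¹ where
  injective := inv_injective.comp h.injective
  mul_eq := by
    have hcancel : Matrix.diagonal x * Matrix.diagonal x⁻¹ = 1 := by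
      rw [Matrix.diagonal_mul_diagonal, ← Matrix.diagonal_one]
      exact congrArg _ (funext fun k => mul_inv_cancel₀ (h.ne_zero k))
    rw [← Units.mul_right_inj N, Units.mul_inv_cancel_left, ← mul_assoc, h.mul_eq, mul_assoc,
      hcancel, mul_one]

end IsEigenframe

theorem exists_isEigenframe (hx : Function.Injective x)
    (h : ∀ k, ∃ v ≠ 0, N *ᵥ v = x k • v) : ∃ U : GL ι K, IsEigenframe N U x := by
  choose u hu₀ hu using h
  have hli : LinearIndependent K (Matrix.of u)ᵀ.col :=
    Module.End.eigenvectors_linearIndependent' (Matrix.toLin' N) x hx u fun k =>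
      Module.End.hasEigenvector_iff.2 ⟨Module.End.mem_eigenspace_iff.2 (hu k), hu₀ k⟩
  refine ⟨(Matrix.linearIndependent_cols_iff_isUnit.1 hli).unit, hx, ?_⟩
  ext i k
  rw [IsUnit.unit_spec, Matrix.mul_diagonal]
  exact (congrFun (hu k) i).trans (mul_comm _ _)

end Eigenframe

section TraceGram

variable {K : Type*} [Field K] {r : ℕ} {N N' : Matrix (Fin r) (Fin r) K}

/-- The Gram matrix of the trace form on the powers of `N`. It is invertible if and only if `N` has
`r` different eigenvalues, and thus turns this condition into a polynomial one. -/
def traceGram (N : Matrix (Fin r) (Fin r) K) : Matrix (Fin r) (Fin r) K :=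
  Matrix.of fun a b => (N ^ (a.1 + b.1)).trace

theorem IsEigenframe.traceGram_eq {U : GL (Fin r) K} {x : Fin r → K} (h : IsEigenframe N U x) :
    traceGram N = (Matrix.vandermonde x)ᵀ * Matrix.vandermonde x := by
  have htrace (k : ℕ) : (N ^ k).trace = ∑ i, x i ^ k := by
    rw [h.pow_eq, Matrix.trace_mul_comm, Units.inv_mul_cancel_left, Matrix.trace_diagonal]
    rfl
  ext a b
  simp only [traceGram, Matrix.of_apply, htrace, Matrix.mul_apply, Matrix.transpose_apply,
    Matrix.vandermonde_apply, ← pow_add]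

theorem IsEigenframe.det_traceGram_ne_zero {U : GL (Fin r) K} {x : Fin r → K}
    (h : IsEigenframe N U x) : (traceGram N).det ≠ 0 := by
  have hx := Matrix.det_vandermonde_ne_zero_iff.2 h.injective
  rw [h.traceGram_eq, Matrix.det_mul, Matrix.det_transpose]
  exact mul_ne_zero hx hx

-- The coefficients of `p` lie in the kernel of the trace form, as `p(N) N ^ b` is nilpotent.
theorem eq_zero_of_isNilpotent_aeval (h : (traceGram N).det ≠ 0) {p : Polynomial K}
    (hdeg : p.natDegree < r) (hp : IsNilpotent (Polynomial.aeval N p)) : p = 0 := by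
  have htrace (b : ℕ) : (Polynomial.aeval N p * N ^ b).trace = 0 := by
    have hcomm : Commute (Polynomial.aeval N p) (N ^ b) := by
      simpa using (Commute.all p (Polynomial.X ^ b)).map (Polynomial.aeval N)
    exact (Matrix.isNilpotent_trace_of_isNilpotent (hcomm.isNilpotent_mul_right hp)).eq_zero
  have hker : (fun a : Fin r => p.coeff a) ᵥ* traceGram N = 0 := by
    funext b
    rw [Pi.zero_apply, ← htrace b, Polynomial.aeval_eq_sum_range' hdeg, Finset.sum_mul,
      Matrix.trace_sum, Finset.sum_range]
    simp only [Matrix.vecMul, dotProduct, traceGram, Matrix.of_apply, smul_mul_assoc, pow_add,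
      Matrix.trace_smul, smul_eq_mul]
  have hcoeff := Matrix.eq_zero_of_vecMul_eq_zero h hker
  ext a
  rcases lt_or_ge a r with ha | ha
  · exact congrFun hcoeff ⟨a, ha⟩
  · exact Polynomial.coeff_eq_zero_of_natDegree_lt (hdeg.trans_le ha)

theorem squarefree_charpoly (h : (traceGram N).det ≠ 0) : Squarefree N.charpoly := by
  rintro q ⟨s, hs⟩
  have hq : q ≠ 0 ∧ q * s ≠ 0 := by
    rw [← mul_ne_zero_iff, ← mul_assoc, ← hs]
    exact N.charpoly_monic.ne_zero
  have hnil : IsNilpotent (Polynomial.aeval N (q * s)) := by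
    refine ⟨2, ?_⟩
    rw [← map_pow, show (q * s) ^ 2 = N.charpoly * s by rw [hs]; ring, map_mul,
      Matrix.aeval_self_charpoly, zero_mul]
  have hdeg : q.natDegree + (q * s).natDegree = r := by
    rw [← Polynomial.natDegree_mul hq.1 hq.2, ← mul_assoc, ← hs,
      Matrix.charpoly_natDegree_eq_dim, Fintype.card_fin]
  have hge : r ≤ (q * s).natDegree :=
    not_lt.1 fun hlt => hq.2 (eq_zero_of_isNilpotent_aeval h hlt hnil)
  rw [Polynomial.isUnit_iff_degree_eq_zero, Polynomial.degree_eq_natDegree hq.1,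
    show q.natDegree = 0 by omega, Nat.cast_zero]

theorem exists_isEigenframe_of_det_traceGram_ne_zero [IsAlgClosed K]
    (h : (traceGram N).det ≠ 0) : ∃ U x, IsEigenframe N U x := by
  classical
  have hnodup : N.charpoly.roots.Nodup :=
    Polynomial.nodup_roots (PerfectField.separable_iff_squarefree.2 (squarefree_charpoly h))
  have hcard : N.charpoly.roots.toFinset.card = r := by
    rw [Multiset.toFinset_card_of_nodup hnodup, IsAlgClosed.card_roots_eq_natDegree,
      Matrix.charpoly_natDegree_eq_dim, Fintype.card_fin]
  let e := (Finset.equivFinOfCardEq hcard).symm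
  obtain ⟨U, hU⟩ := exists_isEigenframe (N := N) (x := fun k => (e k).1)
    (Subtype.val_injective.comp e.injective) fun k => by
      have hroot : (N.charpoly).eval (e k).1 = 0 :=
        Polynomial.isRoot_of_mem_roots (Multiset.mem_toFinset.1 (e k).2)
      rw [Matrix.eval_charpoly] at hroot
      obtain ⟨v, hv, hv₀⟩ := Matrix.exists_mulVec_eq_zero_iff.2 hroot
      refine ⟨v, hv, ?_⟩
      rw [Matrix.sub_mulVec, sub_eq_zero] at hv₀
      rw [← hv₀, Matrix.scalar_apply, ← Matrix.smul_one_eq_diagonal, Matrix.smul_mulVec,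
        Matrix.one_mulVec]
  exact ⟨U, _, hU⟩

end TraceGram

section TransversalPair

variable {K : Type*} [Field K] {r : ℕ} {N N' : Matrix (Fin r) (Fin r) K}

/-- The matrix whose rows are the entries of the products `N ^ a * N' ^ b`. -/
def powProducts (N N' : Matrix (Fin r) (Fin r) K) : Matrix (Fin r × Fin r) (Fin r × Fin r) K :=
  Matrix.of fun ab ij => (N ^ ab.1.1 * N' ^ ab.2.1) ij.1 ij.2

section Overlap

variable {U U' : GL (Fin r) K} {x x' : Fin r → K}

theorem IsEigenframe.powProducts_eq (h : IsEigenframe N U x) (h' : IsEigenframe N' U' x') :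
    powProducts N N' = (Matrix.vandermonde x)ᵀ ⊗ₖ (Matrix.vandermonde x')ᵀ *
      Matrix.diagonal (fun kl => (U⁻¹ * U').val kl.1 kl.2) * (U.valᵀ ⊗ₖ U'⁻¹.val) := by
  ext ⟨a, b⟩ ⟨i, j⟩
  have hprod : N ^ a.1 * N' ^ b.1 = U.val * (Matrix.diagonal (x ^ a.1) * (U⁻¹ * U').val *
      Matrix.diagonal (x' ^ b.1)) * U'⁻¹.val := by
    rw [h.pow_eq, h'.pow_eq, Units.val_mul]
    simp only [mul_assoc]
  rw [powProducts, Matrix.of_apply, hprod]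
  simp only [Matrix.mul_apply (M := U.val * _), Matrix.mul_apply (M := U.val),
    Matrix.mul_diagonal, Matrix.diagonal_mul, Matrix.mul_apply (M := _ * Matrix.diagonal _),
    Matrix.kroneckerMap_apply, Matrix.transpose_apply, Matrix.vandermonde_apply, Pi.pow_apply,
    Fintype.sum_prod_type_right, Finset.sum_mul]
  exact Finset.sum_congr rfl fun l _ => Finset.sum_congr rfl fun k _ => by ring

theorem IsEigenframe.det_powProducts_ne_zero_iff (h : IsEigenframe N U x)
    (h' : IsEigenframe N' U' x') :
    (powProducts N N').det ≠ 0 ↔ ∀ k l, (U⁻¹ * U').val k l ≠ 0 := by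
  have hx := Matrix.det_vandermonde_ne_zero_iff.2 h.injective
  have hx' := Matrix.det_vandermonde_ne_zero_iff.2 h'.injective
  have hU := ((Matrix.isUnit_iff_isUnit_det _).1 U.isUnit).ne_zero
  have hU' := ((Matrix.isUnit_iff_isUnit_det _).1 U'⁻¹.isUnit).ne_zero
  rw [h.powProducts_eq h', Matrix.det_mul, Matrix.det_mul, Matrix.det_kronecker,
    Matrix.det_kronecker, Matrix.det_transpose, Matrix.det_transpose, Matrix.det_transpose,
    Matrix.det_diagonal, mul_ne_zero_iff, mul_ne_zero_iff, Finset.prod_ne_zero_iff]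
  simp only [Finset.mem_univ, true_imp_iff, Prod.forall]
  exact ⟨fun H => H.1.2, fun H => ⟨⟨mul_ne_zero (pow_ne_zero _ hx) (pow_ne_zero _ hx'), H⟩,
    mul_ne_zero (pow_ne_zero _ hU) (pow_ne_zero _ hU')⟩⟩

end Overlap

/-- `N` and `N'` have simple spectra, and the matrix of each of their eigenbases with respect to the
other one has no zero entry. -/
def TransversalPair (N N' : Matrix (Fin r) (Fin r) K) : Prop :=
  ∃ U U' x x', IsEigenframe N U x ∧ IsEigenframe N' U' x' ∧
    (∀ k l, (U⁻¹ * U').val k l ≠ 0) ∧ ∀ k l, (U'⁻¹ * U).val k l ≠ 0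

theorem transversalPair_iff [IsAlgClosed K] :
    TransversalPair N N' ↔ (traceGram N).det ≠ 0 ∧ (traceGram N').det ≠ 0 ∧
      (powProducts N N').det ≠ 0 ∧ (powProducts N' N).det ≠ 0 := by
  constructor
  · rintro ⟨U, U', x, x', h, h', hV, hV'⟩
    exact ⟨h.det_traceGram_ne_zero, h'.det_traceGram_ne_zero,
      (h.det_powProducts_ne_zero_iff h').2 hV, (h'.det_powProducts_ne_zero_iff h).2 hV'⟩
  · rintro ⟨hN, hN', hV, hV'⟩
    obtain ⟨U, x, h⟩ := exists_isEigenframe_of_det_traceGram_ne_zero hN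
    obtain ⟨U', x', h'⟩ := exists_isEigenframe_of_det_traceGram_ne_zero hN'
    exact ⟨U, U', x, x', h, h', (h.det_powProducts_ne_zero_iff h').1 hV,
      (h'.det_powProducts_ne_zero_iff h).1 hV'⟩

namespace TransversalPair

theorem symm (h : TransversalPair N N') : TransversalPair N' N := by
  obtain ⟨U, U', x, x', h, h', hV, hV'⟩ := h
  exact ⟨U', U, x', x, h', h, hV', hV⟩

theorem smul (h : TransversalPair N N') {c c' : K} (hc : c ≠ 0) (hc' : c' ≠ 0) :
    TransversalPair (c • N) (c' • N') := by
  obtain ⟨U, U', x, x', h, h', hV, hV'⟩ := h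
  exact ⟨U, U', _, _, h.smul hc, h'.smul hc', hV, hV'⟩

theorem inv_left {N : GL (Fin r) K} (h : TransversalPair N.val N') :
    TransversalPair N⁻¹.val N' := by
  obtain ⟨U, U', x, x', h, h', hV, hV'⟩ := h
  exact ⟨U, U', _, x', h.inv, h', hV, hV'⟩

theorem inv_mul_apply_ne_zero (h : TransversalPair N N') {U U' : GL (Fin r) K} {x x' : Fin r → K}
    (hU : IsEigenframe N U x) (hU' : IsEigenframe N' U' x') (k l : Fin r) :
    (U⁻¹ * U').val k l ≠ 0 := by
  obtain ⟨_, _, _, _, h, h', hV, -⟩ := h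
  exact (hU.det_powProducts_ne_zero_iff hU').1 ((h.det_powProducts_ne_zero_iff h').2 hV) k l

end TransversalPair

theorem one_sub_vecMulVec_mul_self {R ι : Type*} [CommRing R] [Fintype ι] [DecidableEq ι]
    {u w : ι → R} (h : w ⬝ᵥ u = 2) :
    (1 - Matrix.vecMulVec u w) * (1 - Matrix.vecMulVec u w) = 1 := by
  have hsq : Matrix.vecMulVec u w * Matrix.vecMulVec u w = 2 • Matrix.vecMulVec u w := by
    rw [Matrix.vecMulVec_mul_vecMulVec, h, Matrix.vecMulVec_smul]
    exact ofNat_smul_eq_nsmul R 2 _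
  rw [sub_mul, mul_sub, mul_sub, hsq, two_smul, one_mul, mul_one, one_mul]
  abel

theorem exists_mul_self_eq_one_apply_ne_zero (K : Type*) [Field K] [CharZero K] (r : ℕ) [NeZero r] :
    ∃ V : GL (Fin r) K, V * V = 1 ∧ ∀ i j, V.val i j ≠ 0 := by
  let w : Fin r → K := Pi.single 0 (2 * (r : K) + 2) - 2
  have hw : w ⬝ᵥ 1 = 2 := by
    simp [w, dotProduct, mul_comm]
  have hV := one_sub_vecMulVec_mul_self hw
  have hr : (r : K) ≠ 0 := NeZero.ne _
  have hr' : (2 * r : K) ≠ 1 := fun h => by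
    have : 2 * r = 1 := by exact_mod_cast h
    omega
  refine ⟨⟨_, _, hV, hV⟩, Units.ext hV, fun i j hij => ?_⟩
  simp only [Matrix.sub_apply, Matrix.one_apply, Matrix.vecMulVec_apply, one_mul, w,
    Pi.sub_apply, Pi.single_apply, Pi.ofNat_apply] at hij
  split_ifs at hij
  · exact hr' (by linear_combination -hij)
  · norm_num at hij
  · exact hr (by linear_combination -hij / 2)
  · norm_num at hij

theorem exists_transversalPair (K : Type*) [Field K] [CharZero K] (r : ℕ) [NeZero r] :
    ∃ X V : GL (Fin r) K, V * V = 1 ∧ TransversalPair X.val (V * X * V).val := by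
  let x : Fin r → K := fun i => (i.1 + 1 : ℕ)
  have hx : Function.Injective x :=
    Nat.cast_injective.comp ((add_left_injective 1).comp Fin.val_injective)
  have hunit : IsUnit (Matrix.diagonal x) :=
    Matrix.isUnit_diagonal.2 (Pi.isUnit_iff.2 fun i => (Nat.cast_ne_zero.2 i.1.succ_ne_zero).isUnit)
  obtain ⟨V, hV, hne⟩ := exists_mul_self_eq_one_apply_ne_zero K r
  have hinv : V⁻¹ = V := inv_eq_of_mul_eq_one_left hV
  have hX : IsEigenframe hunit.unit.val 1 x :=
    ⟨hx, by rw [IsUnit.unit_spec, Units.val_one, mul_one, one_mul]⟩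
  have hX' := hX.conj V
  rw [hinv, mul_one] at hX'
  refine ⟨hunit.unit, V, hV, 1, V, x, x, hX, hX', ?_, ?_⟩
  · rwa [inv_one, one_mul]
  · rwa [hinv, mul_one]

end TransversalPair

section MoorePenrose

open scoped ComplexOrder

variable {p q : Type} [Fintype p] [Fintype q] [DecidableEq q] {A : Matrix p q ℂ} {B : Matrix q p ℂ}

theorem IsMoorePenrose.mul_eq_one {X : Matrix q p ℂ} (h : IsMoorePenrose A X) (hB : B * A = 1) :
    X * A = 1 :=
  calc X * A = B * (A * X * A) := by
        rw [Matrix.mul_assoc, ← Matrix.mul_assoc B, hB, Matrix.one_mul]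
    _ = 1 := by rw [h.1, hB]

theorem exists_isMoorePenrose (hB : B * A = 1) : ∃ X, IsMoorePenrose A X := by
  have hinjective : Function.Injective A.mulVec := fun u v huv => by
    simpa [Matrix.mulVec_mulVec, hB] using congrArg B.mulVec huv
  have hunit : IsUnit (Aᴴ * A).det :=
    (Matrix.isUnit_iff_isUnit_det _).1 (Matrix.PosDef.conjTranspose_mul_self A hinjective).isUnit
  have hleft : (Aᴴ * A)⁻¹ * Aᴴ * A = 1 := by
    rw [Matrix.mul_assoc, Matrix.nonsing_inv_mul _ hunit]
  refine ⟨(Aᴴ * A)⁻¹ * Aᴴ, ?_, ?_, ?_, ?_⟩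
  · rw [Matrix.mul_assoc, hleft, Matrix.mul_one]
  · rw [hleft, Matrix.one_mul]
  · simp only [Matrix.conjTranspose_mul, Matrix.conjTranspose_conjTranspose,
      Matrix.conjTranspose_nonsing_inv, Matrix.mul_assoc]
  · rw [hleft, Matrix.conjTranspose_one]

end MoorePenrose

section OrderedProducts

variable {H : Type*} {d : ℕ} {f g : Fin d → H} {m : ℕ}

theorem take_ofFn_congr (h : ∀ k : Fin d, k.1 < m → f k = g k) :
    (List.ofFn f).take m = (List.ofFn g).take m := by
  refine List.ext_getElem (by simp) fun i hi _ => ?_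
  rw [List.length_take] at hi
  simpa only [List.getElem_take, List.getElem_ofFn] using h _ (hi.trans_le (min_le_left _ _))

theorem drop_ofFn_congr (h : ∀ k : Fin d, m ≤ k.1 → f k = g k) :
    (List.ofFn f).drop m = (List.ofFn g).drop m := by
  refine List.ext_getElem (by simp) fun i _ _ => ?_
  simpa only [List.getElem_drop, List.getElem_ofFn] using h _ (Nat.le_add_right _ _)

variable [Monoid H]

theorem take_ofFn_prod_succ (f : Fin d → H) (hm : m < d) :
    ((List.ofFn f).take (m + 1)).prod = ((List.ofFn f).take m).prod * f ⟨m, hm⟩ := by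
  rw [List.prod_take_succ _ _ (by simpa using hm), List.getElem_ofFn]

theorem ofFn_prod_eq_take_mul_mul_drop (f : Fin d → H) (hm : m < d) :
    (List.ofFn f).prod =
      ((List.ofFn f).take m).prod * f ⟨m, hm⟩ * ((List.ofFn f).drop (m + 1)).prod := by
  rw [← take_ofFn_prod_succ, List.prod_take_mul_prod_drop]

theorem ofFn_prod_update_one_mul {k : Fin d} (hf : ∀ j, k < j → f j = 1) :
    (List.ofFn (Function.update f k 1)).prod * f k = (List.ofFn f).prod := by
  have htail : ((List.ofFn f).drop (k + 1)).prod = 1 := by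
    rw [drop_ofFn_congr (g := 1) fun j hj => hf j hj]
    exact List.prod_eq_one fun a ha => (List.mem_ofFn.1 (List.mem_of_mem_drop ha)).choose_spec.symm
  rw [ofFn_prod_eq_take_mul_mul_drop f k.2, ofFn_prod_eq_take_mul_mul_drop _ k.2, htail,
    drop_ofFn_congr (g := f) fun j hj => Function.update_of_ne (Fin.ne_of_gt hj) _ _, htail,
    take_ofFn_congr (g := f) fun j hj => Function.update_of_ne (Fin.ne_of_lt hj) _ _,
    Function.update_self, mul_one, mul_one, mul_one]

theorem ofFn_prod_eq_single {k : Fin d} (hf : ∀ j, j ≠ k → f j = 1) :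
    (List.ofFn f).prod = f k := by
  rw [List.ofFn_eq_map, List.prod_map_eq_pow_single k _ fun j hj _ => hf j hj,
    List.count_eq_one_of_mem (List.nodup_finRange d) (List.mem_finRange k), pow_one]

end OrderedProducts

section MiddleProducts

variable {d : ℕ} [NeZero d] {n : Fin d → ℕ}

section Monoid

variable {H : Type*} [Monoid H]

open Classical in
/-- The ordered product of the factors in the middle modes. -/
def midProd (f : Fin d → H) : H :=
  (List.ofFn fun k => if IsMid k then f k else 1).prod

theorem midProd_congr {f g : Fin d → H} (h : ∀ k, IsMid k → f k = g k) :
    midProd f = midProd g := by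
  classical
  exact congrArg (fun f => (List.ofFn f).prod) (funext fun k => ite_congr rfl (h k) fun _ => rfl)

theorem map_midProd {H' : Type*} [Monoid H'] (φ : H →* H') (f : Fin d → H) :
    φ (midProd f) = midProd fun k => φ (f k) := by
  classical
  simp only [midProd, map_list_prod, List.map_ofFn, Function.comp_def, apply_ite φ, map_one]

theorem ofFn_prod_eq_mul_midProd_mul (hd : 2 ≤ d) (f : Fin d → H) :
    (List.ofFn f).prod = f 0 * midProd f * f (lastMode d) := by
  obtain ⟨e, rfl⟩ := Nat.exists_eq_add_of_le' hd
  have hmid (k : Fin e) : IsMid (d := e + 2) k.castSucc.succ := by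
    simp [IsMid, lastMode, Fin.ext_iff, k.2.ne]
  have hzero : ¬ IsMid (0 : Fin (e + 2)) := fun h => h.1 rfl
  have hlast : ¬ IsMid (Fin.last e).succ := fun h => h.2 rfl
  have hmidProd : midProd f = (List.ofFn fun k : Fin e => f k.castSucc.succ).prod := by
    rw [midProd, List.ofFn_succ, List.ofFn_succ', List.concat_eq_append, List.prod_cons,
      List.prod_append, List.prod_singleton, if_neg hzero, if_neg hlast, one_mul, mul_one]
    simp only [hmid, if_true]
  rw [hmidProd, List.ofFn_succ, List.ofFn_succ', List.concat_eq_append, List.prod_cons,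
    List.prod_append, List.prod_singleton, mul_assoc]
  rfl

theorem midProd_eq_single {m : Fin d} (hm : IsMid m) {f : Fin d → H}
    (hf : ∀ k, k ≠ m → f k = 1) : midProd f = f m := by
  classical
  rw [midProd, ofFn_prod_eq_single (k := m), if_pos hm]
  intro k hk
  rw [hf k hk, ite_self]

theorem midProd_eq_mul {p m : Fin d} (hp : IsMid p) (hm : IsMid m) (hpm : p < m) {f : Fin d → H}
    (hf : ∀ k, k ≠ p → k ≠ m → f k = 1) : midProd f = f p * f m := by
  classical
  have hf' (k : Fin d) (hkp : k ≠ p) (hkm : k ≠ m) : (if IsMid k then f k else 1) = 1 := by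
    rw [hf k hkp hkm, ite_self]
  rw [midProd, ← ofFn_prod_update_one_mul (k := m) fun k hk => hf' k (hpm.trans hk).ne' hk.ne',
    ofFn_prod_eq_single (k := p), Function.update_of_ne hpm.ne, if_pos hp, if_pos hm]
  intro k hk
  rcases eq_or_ne k m with rfl | hkm
  · exact Function.update_self _ _ _
  · rw [Function.update_of_ne hkm, hf' k hk hkm]

end Monoid

section Group

variable {H : Type*} [Group H]

/-- The quotient of the middle products that `x` and `y` select from group-valued slices. -/
def midQuot (q : (k : Fin d) → Fin (n k) → H) (x y : Index n) : H :=
  midProd (fun k => q k (x k)) * (midProd fun k => q k (y k))⁻¹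

theorem midQuot_inv (q : (k : Fin d) → Fin (n k) → H) (x y : Index n) :
    (midQuot q x y)⁻¹ = midQuot q y x := by
  rw [midQuot, mul_inv_rev, inv_inv, midQuot]

theorem exists_midQuot_eq {m : Fin d} (hm : IsMid m) (B : Fin (n m) → H) :
    ∃ q : (k : Fin d) → Fin (n k) → H, ∀ x y : Index n,
      midQuot q x y = B (x m) * (B (y m))⁻¹ := by
  let q : (k : Fin d) → Fin (n k) → H := Function.update (fun _ _ => 1) m B
  have hprod (x : Index n) : midProd (fun k => q k (x k)) = B (x m) := by
    rw [midProd_eq_single hm fun k hk => by simp only [q, Function.update_of_ne hk]]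
    simp only [q, Function.update_self]
  exact ⟨q, fun x y => by rw [midQuot, hprod, hprod]⟩

theorem exists_midQuot_eq_of_lt {p m : Fin d} (hp : IsMid p) (hm : IsMid m) (hpm : p < m)
    (A : Fin (n p) → H) (B : Fin (n m) → H) :
    ∃ q : (k : Fin d) → Fin (n k) → H, ∀ x y : Index n,
      midQuot q x y = A (x p) * (B (x m) * (B (y m))⁻¹) * (A (y p))⁻¹ := by
  let q : (k : Fin d) → Fin (n k) → H :=
    Function.update (Function.update (fun _ _ => 1) m B) p A
  have hprod (x : Index n) : midProd (fun k => q k (x k)) = A (x p) * B (x m) := by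
    rw [midProd_eq_mul hp hm hpm fun k hkp hkm => by
      simp only [q, Function.update_of_ne hkp, Function.update_of_ne hkm]]
    simp only [q, Function.update_of_ne hpm.ne', Function.update_self]
  exact ⟨q, fun x y => by rw [midQuot, hprod, hprod, mul_inv_rev]; simp only [mul_assoc]⟩

theorem exists_mul_mul_inv_eq {ι : Type*} (X : H) {V : H} (hV : V * V = 1) {a b a' b' : ι}
    (hne : a ≠ a') : ∃ (A : ι → H) (Z : H),
      A a * Z * (A b)⁻¹ = X ∧ A a' * Z * (A b')⁻¹ = V * X * V := by
  classical
  have hVinv : V⁻¹ = V := inv_eq_of_mul_eq_one_left hV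
  by_cases ha' : b ≠ a' ∧ b' ≠ a'
  · exact ⟨Pi.mulSingle a' (V * X * V * X⁻¹), X, by simp [hne, ha'.1], by simp [ha'.2]⟩
  by_cases ha : b ≠ a ∧ b' ≠ a
  · exact ⟨Pi.mulSingle a (X * (V * X * V)⁻¹), V * X * V, by simp [ha.1, -mul_inv_rev],
      by simp [ha.2, hne.symm]⟩
  obtain ⟨rfl, rfl⟩ | ⟨rfl, rfl⟩ : (b = a ∧ b' = a') ∨ (b = a' ∧ b' = a) := by
    by_cases b = a' <;> by_cases b' = a' <;> grind
  · exact ⟨Pi.mulSingle b' V, X, by simp [hne], by simp [hVinv]⟩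
  · exact ⟨Pi.mulSingle b V, X * V, by simp [hne], by simp [hne, mul_assoc]⟩

end Group

end MiddleProducts

section Realizable

variable {d : ℕ} [NeZero d] {n : Fin d → ℕ} {α β α' β' : Index n} {m m' : Fin d}

theorem IsLastDiff.symm (h : IsLastDiff α β m) : IsLastDiff β α m :=
  ⟨h.1, h.2.1.symm, fun k hk hmk => (h.2.2 k hk hmk).symm⟩

/-- The part of admissibility that concerns the two probe pairs. -/
def ProbesDiffer (α β α' β' : Index n) : Prop :=
  ∃ m m' : Fin d, IsLastDiff α β m ∧ IsLastDiff α' β' m' ∧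
    (m = m' → ¬ (AgreeUpTo m α α' ∧ AgreeUpTo m β β') ∧
      ¬ (AgreeUpTo m α β' ∧ AgreeUpTo m β α'))

variable {H : Type*} [Group H] {Rel : H → H → Prop}

/-- Group-valued slices exist for which the quotients of middle products of two probe pairs are in
the relation `Rel`. -/
def Realizable (Rel : H → H → Prop) (α β α' β' : Index n) : Prop :=
  ∃ q : (k : Fin d) → Fin (n k) → H, Rel (midQuot q α β) (midQuot q α' β')

theorem Realizable.symm [Std.Symm Rel] (h : Realizable Rel α β α' β') :
    Realizable Rel α' β' α β :=
  h.imp fun _ hq => Std.Symm.symm _ _ hq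

theorem Realizable.swap_left (hinv : ∀ a b, Rel a b → Rel a⁻¹ b) (h : Realizable Rel α β α' β') :
    Realizable Rel β α α' β' :=
  h.imp fun q hq => midQuot_inv q α β ▸ hinv _ _ hq

theorem Realizable.swap_right [Std.Symm Rel] (hinv : ∀ a b, Rel a b → Rel a⁻¹ b)
    (h : Realizable Rel α β α' β') : Realizable Rel α β β' α' :=
  ((h.symm).swap_left hinv).symm

theorem realizable_of_lt {X Y : H} (hXY : Rel X Y) (hm : IsLastDiff α β m)
    (hm' : IsLastDiff α' β' m') (hlt : m < m') : Realizable Rel α β α' β' := by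
  let A : Fin (n m) → H := Pi.mulSingle (α m) X
  let B : Fin (n m') → H := Pi.mulSingle (α' m') ((A (α' m))⁻¹ * Y * A (β' m))
  obtain ⟨q, hq⟩ := exists_midQuot_eq_of_lt hm.1 hm'.1 hlt A B
  have hX : midQuot q α β = X := by
    rw [hq, hm.2.2 m' hm'.1 hlt]
    simp [A, hm.2.1.symm]
  have hY : midQuot q α' β' = Y := by
    rw [hq]
    simp [B, hm'.2.1.symm, mul_assoc]
  exact ⟨q, by rwa [hX, hY]⟩

theorem realizable_of_ne {X Y : H} (hXY : Rel X Y) (hm : IsLastDiff α β m)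
    (hm' : IsLastDiff α' β' m) (hα : α' m ≠ α m) (hβ : α' m ≠ β m) :
    Realizable Rel α β α' β' := by
  let A : Fin (n m) → H := Pi.mulSingle (α m) X
  obtain ⟨q, hq⟩ := exists_midQuot_eq hm.1 (Function.update A (α' m) (Y * A (β' m)))
  have hX : midQuot q α β = X := by
    rw [hq]
    simp [A, hα.symm, hβ.symm, hm.2.1.symm]
  have hY : midQuot q α' β' = Y := by
    rw [hq]
    simp [hm'.2.1.symm]
  exact ⟨q, by rwa [hX, hY]⟩

section Involution

variable {X V : H} (hV : V * V = 1) (hXV : Rel X (V * X * V))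

include hV hXV

theorem realizable_of_eq_of_lt {p : Fin d} (hp : IsMid p) (hpm : p < m) (hm : IsLastDiff α β m)
    (hα : α m = α' m) (hβ : β m = β' m) (hne : α p ≠ α' p) : Realizable Rel α β α' β' := by
  obtain ⟨A, Z, hX, hX'⟩ := exists_mul_mul_inv_eq (b := β p) (b' := β' p) X hV hne
  obtain ⟨q, hq⟩ := exists_midQuot_eq_of_lt hp hm.1 hpm A (Pi.mulSingle (α m) Z)
  have hZ : (Pi.mulSingle (α m) Z : Fin (n m) → H) (α m) *
      ((Pi.mulSingle (α m) Z : Fin (n m) → H) (β m))⁻¹ = Z := by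
    simp [hm.2.1.symm]
  refine ⟨q, ?_⟩
  rwa [hq, hq, ← hα, ← hβ, hZ, hX, hX']

theorem realizable_of_not_agreeUpTo [Std.Symm Rel] (hinv : ∀ a b, Rel a b → Rel a⁻¹ b)
    (hm : IsLastDiff α β m) (hα : α m = α' m) (hβ : β m = β' m)
    (h : ¬ (AgreeUpTo m α α' ∧ AgreeUpTo m β β')) : Realizable Rel α β α' β' := by
  obtain ⟨p, hp, hpm, hne⟩ : ∃ p, IsMid p ∧ p ≤ m ∧ (α p ≠ α' p ∨ β p ≠ β' p) := by
    simp only [AgreeUpTo] at h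
    grind
  have hlt : p < m := lt_of_le_of_ne hpm (by rintro rfl; exact hne.elim (· hα) (· hβ))
  rcases hne with hne | hne
  · exact realizable_of_eq_of_lt hV hXV hp hlt hm hα hβ hne
  · exact ((realizable_of_eq_of_lt hV hXV hp hlt hm.symm hβ hα hne).swap_left hinv).swap_right hinv

theorem ProbesDiffer.realizable [Std.Symm Rel] (hinv : ∀ a b, Rel a b → Rel a⁻¹ b)
    (h : ProbesDiffer α β α' β') : Realizable Rel α β α' β' := by
  obtain ⟨m, m', hm, hm', hne⟩ := h
  rcases lt_trichotomy m m' with hlt | rfl | hlt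
  · exact realizable_of_lt hXV hm hm' hlt
  · by_cases hα' : α' m ≠ α m ∧ α' m ≠ β m
    · exact realizable_of_ne hXV hm hm' hα'.1 hα'.2
    by_cases hβ' : β' m ≠ α m ∧ β' m ≠ β m
    · exact (realizable_of_ne hXV hm hm'.symm hβ'.1 hβ'.2).swap_right hinv
    have hαβ' := hm'.2.1
    obtain ⟨hα, hβ⟩ | ⟨hα, hβ⟩ : (α m = α' m ∧ β m = β' m) ∨ (α m = β' m ∧ β m = α' m) := by
      grind
    · exact realizable_of_not_agreeUpTo hV hXV hinv hm hα hβ (hne rfl).1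
    · exact (realizable_of_not_agreeUpTo hV hXV hinv hm hα hβ (hne rfl).2).swap_right hinv
  · exact (realizable_of_lt (Std.Symm.symm _ _ hXV) hm' hm hlt).symm

end Involution

end Realizable

section Generic

attribute [local instance] Matrix.linftyOpNormedRing Matrix.linftyOpNormedAlgebra

theorem isAddHaarMeasure_volume_pi {ι : Type*} [Fintype ι] {G : ι → Type*}
    [∀ i, NormedAddCommGroup (G i)] [∀ i, MeasureSpace (G i)] [∀ i, BorelSpace (G i)]
    [∀ i, SigmaFinite (volume : Measure (G i))]
    [∀ i, Measure.IsAddHaarMeasure (volume : Measure (G i))] :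
    (volume : Measure (∀ i, G i)).IsAddHaarMeasure :=
  Measure.pi.isAddHaarMeasure _

variable {d r : ℕ} {n : Fin d → ℕ}

instance isAddHaarMeasure_volume_cores : (volume : Measure (Cores n r)).IsAddHaarMeasure := by
  have hslice : (volume : Measure (Fin r → Fin r → ℂ)).IsAddHaarMeasure :=
    isAddHaarMeasure_volume_pi
  have hcore (k : Fin d) : (volume : Measure (Fin (n k) → Fin r → Fin r → ℂ)).IsAddHaarMeasure :=
    isAddHaarMeasure_volume_pi
  have hfinite (k : Fin d) : SigmaFinite (volume : Measure (Fin (n k) → Fin r → Fin r → ℂ)) :=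
    Measure.pi.sigmaFinite _
  exact isAddHaarMeasure_volume_pi

theorem ae_det_ne_zero {ι : Type*} [Fintype ι] [DecidableEq ι] {M : Cores n r → Matrix ι ι ℂ}
    (hM : Differentiable ℂ M) {Q₀ : Cores n r} (h₀ : (M Q₀).det ≠ 0) :
    ∀ᵐ Q : Cores n r, (M Q).det ≠ 0 :=
  ae_ne_zero_of_differentiable volume (differentiable_det hM) h₀

theorem ae_isUnit_minor (k : Fin d) (e : Fin r × Fin r ↪ Fin (n k)) :
    ∀ᵐ Q : Cores n r, IsUnit ((unfoldAngle (Q k)).submatrix e id) := by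
  let Q₀ : Cores n r := Function.update 0 k fun a i j => if a = e (i, j) then 1 else 0
  have hone : (unfoldAngle (Q₀ k)).submatrix e id = 1 := by
    ext x y
    simp [Q₀, unfoldAngle, Matrix.one_apply]
  have hdiff : Differentiable ℂ fun Q : Cores n r => (unfoldAngle (Q k)).submatrix e id := by
    refine differentiable_matrix_iff.2 fun x y => ?_
    change Differentiable ℂ fun Q : Cores n r => Q k (e x) y.1 y.2
    fun_prop
  filter_upwards [ae_det_ne_zero hdiff (Q₀ := Q₀) (by simp [hone])] with Q hQ
  exact (Matrix.isUnit_iff_isUnit_det _).2 hQ.isUnit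

theorem differentiable_coreSlice (k : Fin d) (a : Fin (n k)) :
    Differentiable ℂ fun Q : Cores n r => coreSlice Q k a := by
  refine differentiable_matrix_iff.2 fun i j => ?_
  change Differentiable ℂ fun Q : Cores n r => Q k a i j
  fun_prop

/-- The cores with the invertible slices `q k a`. -/
def unitCores (q : (k : Fin d) → Fin (n k) → GL (Fin r) ℂ) : Cores n r :=
  fun k a i j => (q k a).val i j

theorem ae_isUnit_coreSlice (k : Fin d) (a : Fin (n k)) :
    ∀ᵐ Q : Cores n r, IsUnit (coreSlice Q k a) := by
  have hone : (coreSlice (unitCores fun _ _ => 1 : Cores n r) k a).det = 1 := Matrix.det_one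
  filter_upwards [ae_det_ne_zero (differentiable_coreSlice k a) (hone ▸ one_ne_zero)] with Q hQ
  exact (Matrix.isUnit_iff_isUnit_det _).2 hQ.isUnit

variable [NeZero d]

/-- The product of the slices that `x` selects in the middle modes. -/
def midSlices (Q : Cores n r) (x : Index n) : Matrix (Fin r) (Fin r) ℂ :=
  midProd fun k => coreSlice Q k (x k)

/-- The quotient `R^x (R^y)⁻¹` of two products of middle slices. -/
def sliceQuot (Q : Cores n r) (x y : Index n) : Matrix (Fin r) (Fin r) ℂ :=
  midSlices Q x * (midSlices Q y)⁻¹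

/-- A scalar multiple of `sliceQuot` that is a polynomial in the cores. -/
def probeMatrix (Q : Cores n r) (x y : Index n) : Matrix (Fin r) (Fin r) ℂ :=
  midSlices Q x * (midSlices Q y).adjugate

theorem differentiable_midSlices (x : Index n) :
    Differentiable ℂ fun Q : Cores n r => midSlices Q x := by
  classical
  refine differentiable_ofFn_prod (M := fun k (Q : Cores n r) =>
    if IsMid k then coreSlice Q k (x k) else 1) fun k => ?_
  by_cases hk : IsMid k
  · simpa only [if_pos hk] using differentiable_coreSlice k (x k)
  · simpa only [if_neg hk] using differentiable_const _

theorem differentiable_probeMatrix (x y : Index n) :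
    Differentiable ℂ fun Q : Cores n r => probeMatrix Q x y :=
  differentiable_matrix_mul (differentiable_midSlices x)
    (differentiable_adjugate (differentiable_midSlices y))

theorem isUnit_midSlices {Q : Cores n r} (hQ : ∀ k a, IsUnit (coreSlice Q k a)) (x : Index n) :
    IsUnit (midSlices Q x) := by
  classical
  refine List.prod_isUnit fun a ha => ?_
  obtain ⟨k, rfl⟩ := List.mem_ofFn.1 ha
  split_ifs
  exacts [hQ k (x k), isUnit_one]

theorem probeMatrix_eq_smul {Q : Cores n r} (x : Index n) {y : Index n}
    (hy : IsUnit (midSlices Q y)) :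
    probeMatrix Q x y = (midSlices Q y).det • sliceQuot Q x y := by
  have hdet := ((Matrix.isUnit_iff_isUnit_det _).1 hy).ne_zero
  rw [probeMatrix, sliceQuot, Matrix.inv_def, Ring.inverse_eq_inv, mul_smul_comm,
    smul_inv_smul₀ hdet]

theorem midSlices_unitCores (q : (k : Fin d) → Fin (n k) → GL (Fin r) ℂ) (x : Index n) :
    midSlices (unitCores q) x = (midProd fun k => q k (x k)).val :=
  (map_midProd (Units.coeHom _) _).symm

theorem probeMatrix_unitCores (q : (k : Fin d) → Fin (n k) → GL (Fin r) ℂ) (x y : Index n) :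
    ∃ c : ℂ, c ≠ 0 ∧ probeMatrix (unitCores q) x y = c • (midQuot q x y).val := by
  have hy := midSlices_unitCores q y
  refine ⟨_, ((Matrix.isUnit_iff_isUnit_det _).1 (midProd fun k => q k (y k)).isUnit).ne_zero, ?_⟩
  rw [probeMatrix_eq_smul x (hy ▸ Units.isUnit _), sliceQuot, hy, midSlices_unitCores,
    ← Matrix.coe_units_inv, ← Units.val_mul, midQuot]

theorem exists_transversalPair_probeMatrix [NeZero r] {α β α' β' : Index n}
    (h : ProbesDiffer α β α' β') :
    ∃ Q : Cores n r, TransversalPair (probeMatrix Q α β) (probeMatrix Q α' β') := by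
  obtain ⟨X, V, hV, hXV⟩ := exists_transversalPair ℂ r
  let Rel : GL (Fin r) ℂ → GL (Fin r) ℂ → Prop := fun N N' => TransversalPair N.val N'.val
  have : Std.Symm Rel := ⟨fun _ _ h => h.symm⟩
  obtain ⟨q, hq⟩ := h.realizable (Rel := Rel) hV hXV fun _ _ h => h.inv_left
  obtain ⟨c, hc, hN⟩ := probeMatrix_unitCores q α β
  obtain ⟨c', hc', hN'⟩ := probeMatrix_unitCores q α' β'
  exact ⟨unitCores q, hN ▸ hN' ▸ hq.smul hc hc'⟩

theorem ae_transversalPair_probeMatrix [NeZero r] {α β α' β' : Index n}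
    (h : ProbesDiffer α β α' β') :
    ∀ᵐ Q : Cores n r, TransversalPair (probeMatrix Q α β) (probeMatrix Q α' β') := by
  have hgram (x y : Index n) :
      Differentiable ℂ fun Q : Cores n r => traceGram (probeMatrix Q x y) :=
    differentiable_matrix_iff.2 fun a b =>
      differentiable_trace (differentiable_matrix_pow (differentiable_probeMatrix x y) _)
  have hpow (x y x' y' : Index n) : Differentiable ℂ fun Q : Cores n r =>
      powProducts (probeMatrix Q x y) (probeMatrix Q x' y') :=
    differentiable_matrix_iff.2 fun _ _ => differentiable_matrix_iff.1
      (differentiable_matrix_mul (differentiable_matrix_pow (differentiable_probeMatrix x y) _)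
        (differentiable_matrix_pow (differentiable_probeMatrix x' y') _)) _ _
  obtain ⟨Q₀, h₀⟩ := exists_transversalPair_probeMatrix (r := r) h
  obtain ⟨hN, hN', hV, hV'⟩ := transversalPair_iff.1 h₀
  filter_upwards [ae_det_ne_zero (hgram α β) hN, ae_det_ne_zero (hgram α' β') hN',
    ae_det_ne_zero (hpow α β α' β') hV, ae_det_ne_zero (hpow α' β' α β) hV'] with Q h₁ h₂ h₃ h₄
  exact transversalPair_iff.2 ⟨h₁, h₂, h₃, h₄⟩

/-- The genericity conditions that the algorithm relies on. -/
structure IsGeneric (Q : Cores n r) : Prop where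
  isUnit_minor : ∀ (k : Fin d) (e : Fin r × Fin r ↪ Fin (n k)),
    IsUnit ((unfoldAngle (Q k)).submatrix e id)
  isUnit_coreSlice : ∀ (k : Fin d) (a : Fin (n k)), IsUnit (coreSlice Q k a)
  transversalPair : ∀ α β α' β' : Index n, ProbesDiffer α β α' β' →
    TransversalPair (probeMatrix Q α β) (probeMatrix Q α' β')

theorem ae_isGeneric [NeZero r] : ∀ᵐ Q : Cores n r, IsGeneric Q := by
  have hminor := ae_all_iff.2 fun k => ae_all_iff.2 (ae_isUnit_minor (n := n) (r := r) k)
  have hslice := ae_all_iff.2 fun k => ae_all_iff.2 (ae_isUnit_coreSlice (n := n) (r := r) k)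
  have htransversal : ∀ᵐ Q : Cores n r, ∀ α β α' β' : Index n, ProbesDiffer α β α' β' →
      TransversalPair (probeMatrix Q α β) (probeMatrix Q α' β') := by
    simp only [ae_all_iff]
    exact fun _ _ _ _ h => ae_transversalPair_probeMatrix h
  filter_upwards [hminor, hslice, htransversal] with Q h₁ h₂ h₃
  exact ⟨h₁, h₂, h₃⟩

end Generic

section BlockMatrices

variable {r : ℕ}

theorem permPi_blockDiag (K : Fin r → Matrix (Fin r) (Fin r) ℂ) :
    permPi (blockDiag K) = Matrix.blockDiagonal K := by
  ext x y
  simp only [permPi, blockDiag, Matrix.submatrix_apply, Matrix.of_apply, Prod.fst_swap,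
    Prod.snd_swap, Matrix.blockDiagonal_apply]

theorem isUnit_blockDiagonal_iff {R ι κ : Type*} [CommRing R] [Fintype ι] [DecidableEq ι]
    [Fintype κ] [DecidableEq κ] {P : κ → Matrix ι ι R} :
    IsUnit (Matrix.blockDiagonal P) ↔ ∀ k, IsUnit (P k) := by
  simp only [Matrix.isUnit_iff_isUnit_det, Matrix.det_blockDiagonal, IsUnit.prod_univ_iff]

theorem eq_blockDiagonal_of_diagonal_mul {R ι κ : Type*} [CommRing R] [IsDomain R] [Fintype ι]
    [DecidableEq ι] [Fintype κ] [DecidableEq κ] {x : κ → R} (hx : Function.Injective x)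
    {C : Matrix (ι × κ) (ι × κ) R}
    (h : Matrix.diagonal (fun y => x y.2) * C = C * Matrix.diagonal fun y => x y.2) :
    C = Matrix.blockDiagonal C.blockDiag := by
  ext ⟨i, k⟩ ⟨j, l⟩
  rcases eq_or_ne k l with rfl | hkl
  · rw [Matrix.blockDiagonal_apply_eq, Matrix.blockDiag_apply]
  · have hentry := congrFun (congrFun h (i, k)) (j, l)
    rw [Matrix.diagonal_mul, Matrix.mul_diagonal, mul_comm (C _ _)] at hentry
    rw [Matrix.blockDiagonal_apply_ne _ _ _ hkl]
    exact (mul_eq_mul_right_iff.1 hentry).resolve_left (hx.ne hkl)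

theorem one_kronecker_mul (M N : Matrix (Fin r) (Fin r) ℂ) :
    ((1 : Matrix (Fin r) (Fin r) ℂ) ⊗ₖ M) * ((1 : Matrix (Fin r) (Fin r) ℂ) ⊗ₖ N) =
      (1 : Matrix (Fin r) (Fin r) ℂ) ⊗ₖ (M * N) := by
  rw [← Matrix.mul_kronecker_mul, one_mul]

theorem one_kronecker_diagonal (x : Fin r → ℂ) :
    (1 : Matrix (Fin r) (Fin r) ℂ) ⊗ₖ Matrix.diagonal x =
      Matrix.diagonal fun y : Fin r × Fin r => x y.2 := by
  rw [← Matrix.diagonal_one, Matrix.diagonal_kronecker_diagonal]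
  simp only [one_mul]

theorem one_kronecker_inv_mul (U : GL (Fin r) ℂ) :
    ((1 : Matrix (Fin r) (Fin r) ℂ) ⊗ₖ U⁻¹.val) *
      ((1 : Matrix (Fin r) (Fin r) ℂ) ⊗ₖ U.val) = 1 := by
  rw [one_kronecker_mul, Units.inv_mul, Matrix.one_kronecker_one]

theorem subBlock_blockDiagonal_mul (P : Fin r → Matrix (Fin r) (Fin r) ℂ)
    (F : Matrix (Fin r × Fin r) (Fin r × Fin r) ℂ) (j k : Fin r) :
    subBlock (Matrix.blockDiagonal P * F) j k = P j * subBlock F j k := by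
  ext a b
  simp only [subBlock, Matrix.of_apply, Matrix.mul_apply, Fintype.sum_prod_type,
    Matrix.blockDiagonal_apply, ite_mul, zero_mul, Finset.sum_ite_eq, Finset.mem_univ, if_true]

theorem subBlock_one_kronecker_mul_blockDiagonal (V : Matrix (Fin r) (Fin r) ℂ)
    (P : Fin r → Matrix (Fin r) (Fin r) ℂ) (j k : Fin r) :
    subBlock (((1 : Matrix (Fin r) (Fin r) ℂ) ⊗ₖ V) * Matrix.blockDiagonal P) j k =
      V j k • P k := by
  ext a b
  simp only [subBlock, Matrix.of_apply, Matrix.mul_apply, Fintype.sum_prod_type,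
    Matrix.kroneckerMap_apply, Matrix.one_apply, Matrix.blockDiagonal_apply, ite_mul, one_mul,
    zero_mul, mul_ite, mul_zero, Finset.sum_ite_eq, Finset.sum_ite_eq', Finset.mem_univ, if_true,
    Matrix.smul_apply, smul_eq_mul]

theorem reshape_unfoldAngle_mul_kronecker {m : ℕ} (A : Fin m → Fin r → Fin r → ℂ)
    (X Y : Matrix (Fin r) (Fin r) ℂ) (a : Fin m) :
    Matrix.of (reshape (unfoldAngle A * (X ⊗ₖ Y)) a) = Xᵀ * Matrix.of (A a) * Y := by
  ext i j
  simp only [reshape, unfoldAngle, Matrix.of_apply, Matrix.mul_apply, Matrix.kroneckerMap_apply,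
    Fintype.sum_prod_type_right, Matrix.transpose_apply, Finset.sum_mul]
  exact Finset.sum_congr rfl fun l _ => Finset.sum_congr rfl fun k _ => by ring

end BlockMatrices

section ProbeFactor

variable {m r : ℕ} {A : Matrix (Fin m) (Fin r × Fin r) ℂ} {B : Matrix (Fin r × Fin r) (Fin m) ℂ}
  {M : Matrix (Fin r) (Fin r) ℂ} {E : Matrix (Fin m) (Fin r × Fin r) ℂ} {U U' : GL (Fin r) ℂ}
  {P P' : Fin r → GL (Fin r) ℂ}

/-- The coefficients of an eigenbasis of `A (I ⊗ M) A⁺` with respect to the columns of `A`, where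
the columns of `U` are eigenvectors of `M` and `P k` is the change of basis in the eigenspace of
the `k`-th eigenvalue. -/
def probeFactor (U : GL (Fin r) ℂ) (P : Fin r → GL (Fin r) ℂ) :
    Matrix (Fin r × Fin r) (Fin r × Fin r) ℂ :=
  ((1 : Matrix (Fin r) (Fin r) ℂ) ⊗ₖ U.val) * Matrix.blockDiagonal fun k => (P k).val

theorem isUnit_probeFactor (U : GL (Fin r) ℂ) (P : Fin r → GL (Fin r) ℂ) :
    IsUnit (probeFactor U P) :=
  (Matrix.IsUnit.kronecker isUnit_one U.isUnit).mul
    (isUnit_blockDiagonal_iff.2 fun k => (P k).isUnit)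

theorem forall_mulVec_col_iff {N : Matrix (Fin m) (Fin m) ℂ} {x : Fin r → ℂ} :
    (∀ j k, N *ᵥ E.col (j, k) = x k • E.col (j, k)) ↔
      N * E = E * Matrix.diagonal fun y : Fin r × Fin r => x y.2 := by
  have hentry (i : Fin m) (y : Fin r × Fin r) :
      (E * Matrix.diagonal fun y : Fin r × Fin r => x y.2) i y = x y.2 * E i y := by
    rw [Matrix.mul_diagonal, mul_comm]
  constructor
  · intro h
    ext i y
    exact (congrFun (h y.1 y.2) i).trans (hentry i y).symm
  · intro h j k
    funext i
    exact (congrFun (congrFun h i) (j, k)).trans (hentry i (j, k))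

theorem IsEigenframe.isEigenbasis {x : Fin r → ℂ} (h : IsEigenframe M U x) (hx₀ : ∀ k, x k ≠ 0)
    (hB : B * A = 1) :
    IsEigenbasis (A * ((1 : Matrix (Fin r) (Fin r) ℂ) ⊗ₖ M) * B)
      (A * ((1 : Matrix (Fin r) (Fin r) ℂ) ⊗ₖ U.val)) := by
  have hinv := one_kronecker_inv_mul U
  set V : Matrix (Fin r × Fin r) (Fin r × Fin r) ℂ := 1 ⊗ₖ U.val
  set W : Matrix (Fin r × Fin r) (Fin r × Fin r) ℂ := 1 ⊗ₖ U⁻¹.val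
  refine ⟨x, h.injective, hx₀, ?_, ?_, ?_⟩
  · rw [forall_mulVec_col_iff, ← one_kronecker_diagonal, Matrix.mul_assoc _ B,
      ← Matrix.mul_assoc B, hB, Matrix.one_mul, Matrix.mul_assoc, Matrix.mul_assoc,
      one_kronecker_mul, one_kronecker_mul, h.mul_eq]
  · have hleft : W * B * (A * V) = 1 := by
      rw [Matrix.mul_assoc, ← Matrix.mul_assoc B, hB, Matrix.one_mul, hinv]
    refine Matrix.mulVec_injective_iff.1 fun u v huv => ?_
    simpa only [Matrix.mulVec_mulVec, hleft, Matrix.one_mulVec] using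
      congrArg (W * B).mulVec huv
  · intro z v hz hv
    rw [← Matrix.range_mulVecLin]
    refine ⟨z⁻¹ • (W * (((1 : Matrix (Fin r) (Fin r) ℂ) ⊗ₖ M) * B)) *ᵥ v, ?_⟩
    rw [Matrix.mulVecLin_apply, Matrix.mulVec_smul, Matrix.mulVec_mulVec, Matrix.mul_assoc A,
      ← Matrix.mul_assoc V, mul_eq_one_comm.1 hinv, Matrix.one_mul, ← Matrix.mul_assoc, hv,
      inv_smul_smul₀ hz]

theorem IsEigenbasis.exists_coefficients {N : Matrix (Fin r × Fin r) (Fin r × Fin r) ℂ}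
    (hE : IsEigenbasis (A * N * B) E) (hB : B * A = 1) :
    ∃ (x : Fin r → ℂ) (C : GL (Fin r × Fin r) ℂ), Function.Injective x ∧ E = A * C.val ∧
      N * C.val = C.val * Matrix.diagonal fun y => x y.2 := by
  obtain ⟨x, hx, hx₀, heigen, hli, -⟩ := hE
  rw [forall_mulVec_col_iff] at heigen
  set D := Matrix.diagonal fun y : Fin r × Fin r => x y.2
  have hD : IsUnit D := Matrix.isUnit_diagonal.2 (Pi.isUnit_iff.2 fun y => (hx₀ y.2).isUnit)
  have hED : A * (B * E) * D = E * D :=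
    calc A * (B * E) * D = A * (B * A) * N * B * E := by
          rw [Matrix.mul_assoc A, Matrix.mul_assoc B, ← heigen]
          simp only [Matrix.mul_assoc]
      _ = E * D := by rw [hB, Matrix.mul_one, heigen]
  have hEA : E = A * (B * E) :=
    Matrix.mul_left_injective_of_inv D _
      (Matrix.mul_nonsing_inv _ ((Matrix.isUnit_iff_isUnit_det _).1 hD)) hED.symm
  have hC : IsUnit (B * E) := by
    refine Matrix.mulVec_injective_iff_isUnit.1 fun u v huv =>
      Matrix.mulVec_injective_iff.2 hli ?_
    rw [hEA, ← Matrix.mulVec_mulVec, huv, Matrix.mulVec_mulVec]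
  refine ⟨x, hC.unit, hx, hEA, ?_⟩
  calc N * (B * E) = B * A * N * (B * E) := by rw [hB, Matrix.one_mul]
    _ = B * (A * N * B * E) := by simp only [Matrix.mul_assoc]
    _ = B * E * D := by rw [heigen, Matrix.mul_assoc]

theorem exists_isEigenframe_of_one_kronecker_mul {x : Fin r → ℂ} (hx : Function.Injective x)
    {C : GL (Fin r × Fin r) ℂ}
    (h : ((1 : Matrix (Fin r) (Fin r) ℂ) ⊗ₖ M) * C.val = C.val * Matrix.diagonal fun y => x y.2) :
    ∃ U, IsEigenframe M U x := by
  refine exists_isEigenframe hx fun k => ?_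
  let v (i : Fin r) : Fin r → ℂ := fun l => C.val (i, l) (k, k)
  have hv (i : Fin r) : M *ᵥ v i = x k • v i := by
    funext l
    have hentry := congrFun (congrFun h (i, l)) (k, k)
    rw [Matrix.mul_diagonal, Matrix.mul_apply, Fintype.sum_prod_type] at hentry
    simp only [Matrix.kroneckerMap_apply, Matrix.one_apply, ite_mul, one_mul, zero_mul,
      Finset.sum_ite_irrel, Finset.sum_const_zero, Finset.sum_ite_eq, Finset.mem_univ,
      if_true] at hentry
    exact hentry.trans (mul_comm _ _)
  obtain ⟨i, hi⟩ : ∃ i, v i ≠ 0 := by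
    by_contra! hv₀
    have hcol : C.val *ᵥ Pi.single (k, k) 1 = C.val *ᵥ 0 := by
      rw [Matrix.mulVec_zero, Matrix.mulVec_single_one]
      exact funext fun y => congrFun (hv₀ y.1) y.2
    have hsingle := Matrix.mulVec_injective_iff_isUnit.2 C.isUnit hcol
    simpa using congrFun hsingle (k, k)
  exact ⟨v i, hi, hv i⟩

theorem IsEigenbasis.exists_probeFactor
    (hE : IsEigenbasis (A * ((1 : Matrix (Fin r) (Fin r) ℂ) ⊗ₖ M) * B) E) (hB : B * A = 1) :
    ∃ x U P, IsEigenframe M U x ∧ E = A * probeFactor U P := by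
  obtain ⟨x, C, hx, hEC, hC⟩ := hE.exists_coefficients hB
  obtain ⟨U, hU⟩ := exists_isEigenframe_of_one_kronecker_mul hx hC
  have hinv := one_kronecker_inv_mul U
  set V : Matrix (Fin r × Fin r) (Fin r × Fin r) ℂ := 1 ⊗ₖ U.val with hV
  set W : Matrix (Fin r × Fin r) (Fin r × Fin r) ℂ := 1 ⊗ₖ U⁻¹.val
  have hVM : (1 ⊗ₖ M) * V = V * Matrix.diagonal fun y => x y.2 := by
    rw [hV, ← one_kronecker_diagonal, one_kronecker_mul, one_kronecker_mul, hU.mul_eq]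
  have hdiag : Matrix.diagonal (fun y => x y.2) * (W * C.val) =
      W * C.val * Matrix.diagonal fun y => x y.2 :=
    calc Matrix.diagonal (fun y => x y.2) * (W * C.val)
        = W * V * Matrix.diagonal (fun y => x y.2) * W * C.val := by
          rw [hinv, Matrix.one_mul, Matrix.mul_assoc]
      _ = W * (1 ⊗ₖ M) * (V * W) * C.val := by
          rw [Matrix.mul_assoc W V, ← hVM]
          simp only [Matrix.mul_assoc]
      _ = W * C.val * Matrix.diagonal fun y => x y.2 := by
          rw [mul_eq_one_comm.1 hinv, Matrix.mul_one, Matrix.mul_assoc, hC, Matrix.mul_assoc]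
  have hblock := eq_blockDiagonal_of_diagonal_mul hx hdiag
  have hunit := isUnit_blockDiagonal_iff.1
    (hblock ▸ (IsUnit.of_mul_eq_one _ hinv).mul C.isUnit)
  refine ⟨x, U, fun k => (hunit k).unit, hU, ?_⟩
  simp only [probeFactor, IsUnit.unit_spec]
  rw [hEC, ← hblock, ← hV, ← Matrix.mul_assoc V, mul_eq_one_comm.1 hinv, Matrix.one_mul]

theorem mul_subBlock_of_probeFactor_mul {F : Matrix (Fin r × Fin r) (Fin r × Fin r) ℂ}
    (h : probeFactor U P * F = probeFactor U' P') (j k : Fin r) :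
    (P j).val * subBlock F j k = (U⁻¹ * U').val j k • (P' k).val := by
  have hF : Matrix.blockDiagonal (fun k => (P k).val) * F =
      (1 ⊗ₖ (U⁻¹ * U').val) * Matrix.blockDiagonal fun k => (P' k).val := by
    rw [Units.val_mul, ← one_kronecker_mul, Matrix.mul_assoc, ← probeFactor, ← h, probeFactor,
      Matrix.mul_assoc, ← Matrix.mul_assoc, one_kronecker_inv_mul, Matrix.one_mul]
  rw [← subBlock_blockDiagonal_mul (fun k => (P k).val), hF,
    subBlock_one_kronecker_mul_blockDiagonal]

theorem probeFactor_mul_inv_blockDiagonal [NeZero r] {K : Fin r → Matrix (Fin r) (Fin r) ℂ}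
    (hunit : IsUnit (Matrix.blockDiagonal K)) {c : Fin r → ℂ} (hc : ∀ l, c l ≠ 0)
    (hK : ∀ l, (P 0).val * K l = c l • (P l).val) :
    probeFactor U P * (Matrix.blockDiagonal K)⁻¹ =
      (P 0).val ⊗ₖ (U.val * Matrix.diagonal c⁻¹) := by
  have hP : Matrix.blockDiagonal (fun l => (P l).val) =
      ((P 0).val ⊗ₖ Matrix.diagonal c⁻¹) * Matrix.blockDiagonal K := by
    rw [Matrix.kronecker_diagonal, ← Matrix.blockDiagonal_mul]
    refine congrArg _ (funext fun l => ?_)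
    rw [op_smul_eq_smul, smul_mul_assoc, hK, Pi.inv_apply, inv_smul_smul₀ (hc l)]
  rw [probeFactor, hP, ← Matrix.mul_assoc, ← Matrix.mul_kronecker_mul, Matrix.one_mul,
    Matrix.mul_nonsing_inv_cancel_right _ _ ((Matrix.isUnit_iff_isUnit_det _).1 hunit)]

end ProbeFactor

section Unfoldings

variable {m m' r : ℕ}

theorem exists_mul_eq_one_of_isUnit_submatrix {p q K : Type*} [Fintype p] [Fintype q]
    [DecidableEq q] [CommRing K] {A : Matrix p q K} {e : q → p}
    (he : IsUnit (A.submatrix e id)) : ∃ B : Matrix q p K, B * A = 1 := by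
  classical
  refine ⟨(A.submatrix e id)⁻¹ * (1 : Matrix p p K).submatrix e id, ?_⟩
  rw [Matrix.mul_assoc, ← Matrix.submatrix_id_id A, ← Matrix.submatrix_mul _ _ _ _ _
    Function.bijective_id, Matrix.one_mul, Matrix.submatrix_id_id,
    Matrix.nonsing_inv_mul _ ((Matrix.isUnit_iff_isUnit_det _).1 he)]

/-- The columns in `G` of the transpose of the unfolding `A_{[1]}`. -/
def bracketCols (A : Fin m → Fin r → Fin r → ℂ) (G : Finset (Fin m)) :
    Matrix (Fin r × Fin r) G ℂ :=
  (unfoldBracket A)ᵀ.submatrix id Subtype.val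

theorem unfoldAngle_mul_kronecker_mul_bracketCols (A : Fin m → Fin r → Fin r → ℂ)
    (Z : Fin m' → Fin r → Fin r → ℂ) (H : Matrix (Fin r) (Fin r) ℂ) (G : Finset (Fin m'))
    (a : Fin m) (b : G) :
    (unfoldAngle A * (((1 : Matrix (Fin r) (Fin r) ℂ) ⊗ₖ H) * bracketCols Z G)) a b =
      (Matrix.of (A a) * (H * Matrix.of (Z b.1))).trace := by
  simp only [Matrix.trace, Matrix.diag, Matrix.mul_apply, Fintype.sum_prod_type, unfoldAngle,
    bracketCols, unfoldBracket, Matrix.of_apply, Matrix.kroneckerMap_apply, Matrix.one_apply,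
    Matrix.submatrix_apply, Matrix.transpose_apply, id, ite_mul, one_mul, zero_mul,
    Finset.sum_ite_irrel, Finset.sum_const_zero, Finset.sum_ite_eq, Finset.mem_univ, if_true]

theorem bracketCols_eq_kronecker_mul {A A' : Fin m → Fin r → Fin r → ℂ}
    {X Y : Matrix (Fin r) (Fin r) ℂ} (h : ∀ a, Matrix.of (A' a) = X * Matrix.of (A a) * Y)
    (G : Finset (Fin m)) : bracketCols A' G = (Yᵀ ⊗ₖ X) * bracketCols A G := by
  ext x b
  have hentry := congrFun (congrFun (h b.1) x.2) x.1
  simp only [Matrix.mul_apply, Matrix.of_apply, Finset.sum_mul] at hentry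
  simp only [bracketCols, unfoldBracket, Matrix.submatrix_apply, Matrix.transpose_apply, id,
    Matrix.of_apply, Matrix.mul_apply, Fintype.sum_prod_type, Matrix.kroneckerMap_apply]
  rw [hentry]
  exact Finset.sum_congr rfl fun i _ => Finset.sum_congr rfl fun j _ => by ring

theorem bracketCols_eq_submatrix (A : Fin m → Fin r → Fin r → ℂ) {G : Finset (Fin m)}
    (e : Fin r × Fin r ≃ G) :
    bracketCols A G = ((unfoldAngle A).submatrix (Subtype.val ∘ e) id)ᵀ.submatrix
      (Equiv.prodComm (Fin r) (Fin r)) e.symm := by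
  ext x b
  simp [bracketCols, unfoldBracket, unfoldAngle]

end Unfoldings

section GenericUnfoldings

variable {d r : ℕ} [NeZero d] {n : Fin d → ℕ} {Q : Cores n r} {k : Fin d}

namespace IsGeneric

theorem exists_mul_unfoldAngle_eq_one (hQ : IsGeneric Q) (hk : r ^ 2 ≤ n k) :
    ∃ B : Matrix (Fin r × Fin r) (Fin (n k)) ℂ, B * unfoldAngle (Q k) = 1 := by
  obtain ⟨e⟩ : Nonempty (Fin r × Fin r ↪ Fin (n k)) :=
    Function.Embedding.nonempty_of_card_le (by simpa [sq] using hk)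
  exact exists_mul_eq_one_of_isUnit_submatrix (hQ.isUnit_minor k e)

theorem exists_mul_bracketCols_eq_one (hQ : IsGeneric Q) {G : Finset (Fin (n k))}
    (hG : G.card = r ^ 2) :
    ∃ W : Matrix G (Fin r × Fin r) ℂ, W * bracketCols (Q k) G = 1 := by
  have e : Fin r × Fin r ≃ G := Fintype.equivOfCardEq (by simp [hG, sq])
  obtain ⟨Z, hZ⟩ := ((Matrix.isUnit_transpose _).2 (hQ.isUnit_minor k
    (e.toEmbedding.trans (Function.Embedding.subtype _)))).exists_left_inv
  refine ⟨Z.submatrix e.symm (Equiv.prodComm (Fin r) (Fin r)), ?_⟩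
  rw [bracketCols_eq_submatrix (Q k) e, Matrix.submatrix_mul_equiv]
  exact (congrArg (Matrix.submatrix · e.symm e.symm) hZ).trans (Matrix.submatrix_one_equiv e.symm)

theorem exists_mul_kronecker_mul_bracketCols_eq_one (hQ : IsGeneric Q) {G : Finset (Fin (n k))}
    (hG : G.card = r ^ 2) {X Y : Matrix (Fin r) (Fin r) ℂ} (hX : IsUnit X) (hY : IsUnit Y) :
    ∃ W : Matrix G (Fin r × Fin r) ℂ, W * ((X ⊗ₖ Y) * bracketCols (Q k) G) = 1 := by
  obtain ⟨W, hW⟩ := hQ.exists_mul_bracketCols_eq_one hG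
  obtain ⟨Z, hZ⟩ := (Matrix.IsUnit.kronecker hX hY).exists_left_inv
  refine ⟨W * Z, ?_⟩
  rw [Matrix.mul_assoc, ← Matrix.mul_assoc Z, hZ, Matrix.one_mul, hW]

end IsGeneric

end GenericUnfoldings

section Observations

variable {d r : ℕ} {n : Fin d → ℕ}

/-- The product of the slices that `x` selects in the modes before `m`. -/
def prefixSlices (Q : Cores n r) (x : Index n) (m : ℕ) : Matrix (Fin r) (Fin r) ℂ :=
  ((List.ofFn fun k : Fin d => coreSlice Q k (x k)).take m).prod

/-- The product of the slices that `x` selects in the modes from `m` on. -/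
def suffixSlices (Q : Cores n r) (x : Index n) (m : ℕ) : Matrix (Fin r) (Fin r) ℂ :=
  ((List.ofFn fun k : Fin d => coreSlice Q k (x k)).drop m).prod

theorem isUnit_prefixSlices {Q : Cores n r} (hQ : ∀ k a, IsUnit (coreSlice Q k a)) (x : Index n)
    (m : ℕ) : IsUnit (prefixSlices Q x m) := by
  refine List.prod_isUnit fun a ha => ?_
  obtain ⟨k, rfl⟩ := List.mem_ofFn.1 (List.mem_of_mem_take ha)
  exact hQ k (x k)

theorem isUnit_suffixSlices {Q : Cores n r} (hQ : ∀ k a, IsUnit (coreSlice Q k a)) (x : Index n)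
    (m : ℕ) : IsUnit (suffixSlices Q x m) := by
  refine List.prod_isUnit fun a ha => ?_
  obtain ⟨k, rfl⟩ := List.mem_ofFn.1 (List.mem_of_mem_drop ha)
  exact hQ k (x k)

theorem place_mem_slicePositions (x : Index n) (i j : Fin d) (S : Finset (Fin (n j)))
    (a : Fin (n i)) (b : S) : place x i j a b.1 ∈ slicePositions x i j S :=
  Finset.mem_image.2 ⟨(a, b.1), by simp, rfl⟩

theorem ringTensor_place_succ (Q : Cores n r) (x : Index n) {m : ℕ} (h : m + 1 < d)
    (a : Fin (n ⟨m + 1, h⟩)) (b : Fin (n ⟨m, Nat.lt_of_succ_lt h⟩)) :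
    ringTensor Q (place x ⟨m + 1, h⟩ ⟨m, Nat.lt_of_succ_lt h⟩ a b) =
      (prefixSlices Q x m * coreSlice Q ⟨m, Nat.lt_of_succ_lt h⟩ b *
        coreSlice Q ⟨m + 1, h⟩ a * suffixSlices Q x (m + 2)).trace := by
  have hoff (k : Fin d) (hk : k.1 < m ∨ m + 2 ≤ k.1) :
      place x ⟨m + 1, h⟩ ⟨m, Nat.lt_of_succ_lt h⟩ a b k = x k := by
    rw [place, Function.update_of_ne, Function.update_of_ne] <;>
    · rintro rfl
      simp at hk
  rw [ringTensor, ofFn_prod_eq_take_mul_mul_drop _ h, take_ofFn_prod_succ _ (Nat.lt_of_succ_lt h),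
    take_ofFn_congr (g := fun k => coreSlice Q k (x k)) fun k hk => by rw [hoff k (Or.inl hk)],
    drop_ofFn_congr (g := fun k => coreSlice Q k (x k)) fun k hk => by rw [hoff k (Or.inr hk)]]
  simp [place, prefixSlices, suffixSlices]

variable [NeZero d] {P : Choice n} {Q : Cores n r}

theorem ringTensor_place_zero_lastMode (hd : 2 ≤ d) (Q : Cores n r) (x : Index n) (a : Fin (n 0))
    (b : Fin (n (lastMode d))) :
    ringTensor Q (place x 0 (lastMode d) a b) =
      (coreSlice Q 0 a * (midSlices Q x * coreSlice Q (lastMode d) b)).trace := by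
  have hne : (0 : Fin d) ≠ lastMode d := by
    rw [Ne, Fin.ext_iff]
    change 0 ≠ d - 1
    omega
  have hmid : midProd (fun k => coreSlice Q k (place x 0 (lastMode d) a b k)) = midSlices Q x :=
    midProd_congr fun k hk => by
      rw [place, Function.update_of_ne hk.2, Function.update_of_ne hk.1]
  rw [ringTensor, ofFn_prod_eq_mul_midProd_mul hd, hmid, mul_assoc]
  simp [place, Function.update_of_ne hne]

/-- The input of the algorithm: the entries of the tensor at the positions in `Δ`. -/
abbrev observations (P : Choice n) (Q : Cores n r) : P.Δ → ℂ :=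
  fun x => ringTensor Q x.1

theorem obsSlice_observations_apply {x : Index n} {i j : Fin d} {S : Finset (Fin (n j))}
    (hS : slicePositions x i j S ⊆ P.Δ) (a : Fin (n i)) (b : S) :
    obsSlice (observations P Q) x i j S a b = ringTensor Q (place x i j a b.1) := by
  rw [obsSlice, Matrix.of_apply, readEntry, dif_pos (hS (place_mem_slicePositions x i j S a b))]

theorem obsSlice_zero_lastMode (hd : 2 ≤ d) {x : Index n} {S : Finset (Fin (n (lastMode d)))}
    (hS : slicePositions x 0 (lastMode d) S ⊆ P.Δ) :
    obsSlice (observations P Q) x 0 (lastMode d) S =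
      unfoldAngle (Q 0) * (((1 : Matrix (Fin r) (Fin r) ℂ) ⊗ₖ midSlices Q x) *
        bracketCols (Q (lastMode d)) S) := by
  ext a b
  rw [obsSlice_observations_apply hS, ringTensor_place_zero_lastMode hd,
    unfoldAngle_mul_kronecker_mul_bracketCols]
  rfl

theorem slicePositions_succ_subset (P : Choice n) {m : ℕ} (h : m + 1 < d) :
    slicePositions P.γ ⟨m + 1, h⟩ ⟨m, Nat.lt_of_succ_lt h⟩ (P.G ⟨m, Nat.lt_of_succ_lt h⟩) ⊆
      P.Δ := by
  have hk : (⟨m + 1, h⟩ : Fin d) = ⟨m, Nat.lt_of_succ_lt h⟩ + 1 := by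
    ext
    rw [Fin.val_add, Fin.val_one', Nat.mod_eq_of_lt (show 1 < d by omega), Nat.mod_eq_of_lt h]
  rw [hk]
  exact (Finset.subset_biUnion_of_mem (fun k : Fin d => slicePositions P.γ (k + 1) k (P.G k))
    (Finset.mem_univ _)).trans Finset.subset_union_right

theorem probe_slicePositions_subset (P : Choice n) :
    slicePositions P.α 0 (lastMode d) P.S ⊆ P.Δ ∧ slicePositions P.β 0 (lastMode d) P.S ⊆ P.Δ ∧
    slicePositions P.α' 0 (lastMode d) P.S' ⊆ P.Δ ∧
    slicePositions P.β' 0 (lastMode d) P.S' ⊆ P.Δ := by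
  refine ⟨?_, ?_, ?_, ?_⟩ <;> intro x hx <;> simp [Choice.Δ, hx]

end Observations

section Probes

variable {d r : ℕ} [NeZero d] {n : Fin d → ℕ} {P : Choice n} {Q : Cores n r}
  {x y α β α' β' : Index n} {S : Finset (Fin (n (lastMode d)))}

theorem Choice.Admissible.sq_le (hP : P.Admissible r) (k : Fin d) : r ^ 2 ≤ n k :=
  hP.2.2.1 k ▸ card_finset_fin_le _

theorem Choice.Admissible.probesDiffer (hP : P.Admissible r) :
    ProbesDiffer P.α P.β P.α' P.β' :=
  hP.2.2.2

namespace IsGeneric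

theorem exists_mul_obsSlice_eq_one (hQ : IsGeneric Q) (hd : 2 ≤ d) (hn : r ^ 2 ≤ n 0)
    (hS : S.card = r ^ 2) (hy : slicePositions y 0 (lastMode d) S ⊆ P.Δ) :
    ∃ W : Matrix S (Fin (n 0)) ℂ, W * obsSlice (observations P Q) y 0 (lastMode d) S = 1 := by
  obtain ⟨B, hB⟩ := hQ.exists_mul_unfoldAngle_eq_one hn
  obtain ⟨W, hW⟩ := hQ.exists_mul_kronecker_mul_bracketCols_eq_one hS isUnit_one
    (isUnit_midSlices hQ.isUnit_coreSlice y)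
  refine ⟨W * B, ?_⟩
  rw [obsSlice_zero_lastMode hd hy, Matrix.mul_assoc, ← Matrix.mul_assoc B, hB, Matrix.one_mul, hW]

theorem obsSlice_mul_moorePenrose (hQ : IsGeneric Q) (hd : 2 ≤ d) (hn : r ^ 2 ≤ n 0)
    (hS : S.card = r ^ 2) (hx : slicePositions x 0 (lastMode d) S ⊆ P.Δ)
    (hy : slicePositions y 0 (lastMode d) S ⊆ P.Δ) {X : Matrix S (Fin (n 0)) ℂ}
    (hX : IsMoorePenrose (obsSlice (observations P Q) y 0 (lastMode d) S) X) :
    ∃ B : Matrix (Fin r × Fin r) (Fin (n 0)) ℂ, B * unfoldAngle (Q 0) = 1 ∧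
      obsSlice (observations P Q) x 0 (lastMode d) S * X =
        unfoldAngle (Q 0) * ((1 : Matrix (Fin r) (Fin r) ℂ) ⊗ₖ sliceQuot Q x y) * B := by
  obtain ⟨W, hW⟩ := hQ.exists_mul_obsSlice_eq_one hd hn hS hy
  have hleft := hX.mul_eq_one hW
  rw [obsSlice_zero_lastMode hd hy, ← Matrix.mul_assoc] at hleft
  refine ⟨((1 : Matrix (Fin r) (Fin r) ℂ) ⊗ₖ midSlices Q y) * bracketCols (Q (lastMode d)) S * X,
    ?_, ?_⟩
  · rw [Matrix.mul_assoc]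
    exact (Matrix.mul_eq_one_comm_of_card_eq _ _ _ (by simp [hS, sq])).1 hleft
  · have hquot : sliceQuot Q x y * midSlices Q y = midSlices Q x :=
      Matrix.nonsing_inv_mul_cancel_right _ _ ((Matrix.isUnit_iff_isUnit_det _).1
        (isUnit_midSlices hQ.isUnit_coreSlice y))
    rw [obsSlice_zero_lastMode hd hx, ← hquot, ← one_kronecker_mul]
    simp only [Matrix.mul_assoc]

theorem isUnit_sliceQuot (hQ : IsGeneric Q) (x y : Index n) : IsUnit (sliceQuot Q x y) :=
  (isUnit_midSlices hQ.isUnit_coreSlice x).mul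
    (Matrix.isUnit_nonsing_inv_iff.2 (isUnit_midSlices hQ.isUnit_coreSlice y))

theorem transversalPair_sliceQuot (hQ : IsGeneric Q) (h : ProbesDiffer α β α' β') :
    TransversalPair (sliceQuot Q α β) (sliceQuot Q α' β') := by
  have hdet (y : Index n) : (midSlices Q y).det ≠ 0 :=
    ((Matrix.isUnit_iff_isUnit_det _).1 (isUnit_midSlices hQ.isUnit_coreSlice y)).ne_zero
  have hquot (x y : Index n) : sliceQuot Q x y = (midSlices Q y).det⁻¹ • probeMatrix Q x y := by
    rw [probeMatrix_eq_smul x (isUnit_midSlices hQ.isUnit_coreSlice y), inv_smul_smul₀ (hdet y)]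
  rw [hquot, hquot]
  exact (hQ.transversalPair _ _ _ _ h).smul (inv_ne_zero (hdet β)) (inv_ne_zero (hdet β'))

theorem exists_isEigenbasis (hQ : IsGeneric Q) (hd : 2 ≤ d) (hn : r ^ 2 ≤ n 0)
    (hS : S.card = r ^ 2) (hx : slicePositions x 0 (lastMode d) S ⊆ P.Δ)
    (hy : slicePositions y 0 (lastMode d) S ⊆ P.Δ) {U : GL (Fin r) ℂ} {z : Fin r → ℂ}
    (hU : IsEigenframe (sliceQuot Q x y) U z) :
    ∃ (X : Matrix S (Fin (n 0)) ℂ) (E : Matrix (Fin (n 0)) (Fin r × Fin r) ℂ),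
      IsMoorePenrose (obsSlice (observations P Q) y 0 (lastMode d) S) X ∧
      IsEigenbasis (obsSlice (observations P Q) x 0 (lastMode d) S * X) E := by
  obtain ⟨W, hW⟩ := hQ.exists_mul_obsSlice_eq_one hd hn hS hy
  obtain ⟨X, hX⟩ := exists_isMoorePenrose hW
  obtain ⟨B, hB, hT⟩ := hQ.obsSlice_mul_moorePenrose hd hn hS hx hy hX
  have hz : ∀ k, z k ≠ 0 := IsEigenframe.ne_zero (N := (hQ.isUnit_sliceQuot x y).unit) hU
  exact ⟨X, _, hX, hT ▸ hU.isEigenbasis hz hB⟩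

theorem exists_eq_unfoldAngle_mul_probeFactor (hQ : IsGeneric Q) (hd : 2 ≤ d) (hn : r ^ 2 ≤ n 0)
    (hS : S.card = r ^ 2) (hx : slicePositions x 0 (lastMode d) S ⊆ P.Δ)
    (hy : slicePositions y 0 (lastMode d) S ⊆ P.Δ) {X : Matrix S (Fin (n 0)) ℂ}
    (hX : IsMoorePenrose (obsSlice (observations P Q) y 0 (lastMode d) S) X)
    {E : Matrix (Fin (n 0)) (Fin r × Fin r) ℂ}
    (hE : IsEigenbasis (obsSlice (observations P Q) x 0 (lastMode d) S * X) E) :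
    ∃ (z : Fin r → ℂ) (U : GL (Fin r) ℂ) (V : Fin r → GL (Fin r) ℂ),
      IsEigenframe (sliceQuot Q x y) U z ∧ E = unfoldAngle (Q 0) * probeFactor U V := by
  obtain ⟨B, hB, hT⟩ := hQ.obsSlice_mul_moorePenrose hd hn hS hx hy hX
  exact (hT ▸ hE).exists_probeFactor hB

end IsGeneric

end Probes

section FirstCore

variable {d r : ℕ} [NeZero d] {n : Fin d → ℕ}

/-- What the eigenbases of the first step look like. The products `Uᵢ⁻¹ U'ⱼ` are generic because
the two probes are. -/
def ValidEigen (Q : Cores n r) (E E' : Matrix (Fin (n 0)) (Fin r × Fin r) ℂ) : Prop :=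
  ∃ (U U' : GL (Fin r) ℂ) (V V' : Fin r → GL (Fin r) ℂ), E = unfoldAngle (Q 0) * probeFactor U V ∧
    E' = unfoldAngle (Q 0) * probeFactor U' V' ∧ ∀ k l, (U⁻¹ * U').val k l ≠ 0

variable {Q : Cores n r} {E E' : Matrix (Fin (n 0)) (Fin r × Fin r) ℂ}

theorem ValidEigen.exists_mul_eq_one (hQ : IsGeneric Q) (hn : r ^ 2 ≤ n 0)
    (h : ValidEigen Q E E') : ∃ W : Matrix (Fin r × Fin r) (Fin (n 0)) ℂ, W * E = 1 := by
  obtain ⟨U, _, V, _, rfl, -, -⟩ := h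
  obtain ⟨B, hB⟩ := hQ.exists_mul_unfoldAngle_eq_one hn
  obtain ⟨Z, hZ⟩ := (isUnit_probeFactor U V).exists_left_inv
  refine ⟨Z * B, ?_⟩
  rw [Matrix.mul_assoc, ← Matrix.mul_assoc B, hB, Matrix.one_mul, hZ]

theorem isUnit_of_units_mul_eq_smul {X Y : GL (Fin r) ℂ} {Z : Matrix (Fin r) (Fin r) ℂ} {c : ℂ}
    (hc : c ≠ 0) (h : X.val * Z = c • Y.val) : IsUnit Z := by
  rw [← Units.isUnit_units_mul X, h]
  exact (Units.mk0 c hc • Y).isUnit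

variable [NeZero r]

/-- What holds after the second step: in the first block column of `F`, the blocks are `(V l)⁻¹` up
to scalars and a common factor on the right. -/
def ValidBlocks (Q : Cores n r) (E : Matrix (Fin (n 0)) (Fin r × Fin r) ℂ)
    (F : Matrix (Fin r × Fin r) (Fin r × Fin r) ℂ) : Prop :=
  ∃ (U Y : GL (Fin r) ℂ) (V : Fin r → GL (Fin r) ℂ) (c : Fin r → ℂ),
    E = unfoldAngle (Q 0) * probeFactor U V ∧ (∀ l, c l ≠ 0) ∧
    ∀ l, (V l).val * subBlock F l 0 = c l • Y.val

/-- What holds after the third step: the matrices `K l` are `(V 0)⁻¹ V l` up to scalars. -/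
def ValidGauge (Q : Cores n r) (E : Matrix (Fin (n 0)) (Fin r × Fin r) ℂ)
    (K : Fin r → Matrix (Fin r) (Fin r) ℂ) : Prop :=
  ∃ (U : GL (Fin r) ℂ) (V : Fin r → GL (Fin r) ℂ) (c : Fin r → ℂ),
    E = unfoldAngle (Q 0) * probeFactor U V ∧ (∀ l, c l ≠ 0) ∧
    ∀ l, (V 0).val * K l = c l • (V l).val

variable {F : Matrix (Fin r × Fin r) (Fin r × Fin r) ℂ} {K : Fin r → Matrix (Fin r) (Fin r) ℂ}

theorem ValidEigen.validBlocks (h : ValidEigen Q E E')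
    {Y : Matrix (Fin r × Fin r) (Fin (n 0)) ℂ} (hY : Y * E = 1) : ValidBlocks Q E (Y * E') := by
  obtain ⟨U, U', V, V', hE, hE', hne⟩ := h
  refine ⟨U, V' 0, V, fun l => (U⁻¹ * U').val l 0, hE, fun l => hne l 0, fun l => ?_⟩
  have hright : probeFactor U V * (Y * unfoldAngle (Q 0)) = 1 := by
    rw [mul_eq_one_comm, Matrix.mul_assoc, ← hE, hY]
  refine mul_subBlock_of_probeFactor_mul (U := U) (U' := U') ?_ l 0
  rw [hE', ← Matrix.mul_assoc Y, ← Matrix.mul_assoc, hright, Matrix.one_mul]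

theorem ValidBlocks.isUnit_subBlock (h : ValidBlocks Q E F) (l : Fin r) :
    IsUnit (subBlock F l 0) := by
  obtain ⟨_, _, _, _, -, hc, hF⟩ := h
  exact isUnit_of_units_mul_eq_smul (hc l) (hF l)

theorem ValidBlocks.validGauge (h : ValidBlocks Q E F) :
    ValidGauge Q E fun l => if l = 0 then 1 else subBlock F 0 0 * (subBlock F l 0)⁻¹ := by
  have hunit (l : Fin r) := (Matrix.isUnit_iff_isUnit_det _).1 (h.isUnit_subBlock l)
  obtain ⟨U, Y, V, c, hE, hc, hF⟩ := h
  have hY (l : Fin r) : Y.val * (subBlock F l 0)⁻¹ = (c l)⁻¹ • (V l).val := by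
    rw [eq_inv_smul_iff₀ (hc l), ← smul_mul_assoc, ← hF,
      Matrix.mul_nonsing_inv_cancel_right _ _ (hunit l)]
  refine ⟨U, V, fun l => c 0 * (c l)⁻¹, hE, fun l => mul_ne_zero (hc 0) (inv_ne_zero (hc l)),
    fun l => ?_⟩
  dsimp only
  split_ifs with hl
  · rw [hl, mul_inv_cancel₀ (hc 0), one_smul, mul_one]
  · rw [← mul_assoc, hF, smul_mul_assoc, hY, smul_smul]

theorem ValidGauge.isUnit_permPi_blockDiag (h : ValidGauge Q E K) :
    IsUnit (permPi (blockDiag K)) := by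
  obtain ⟨_, _, _, -, hc, hK⟩ := h
  rw [permPi_blockDiag, isUnit_blockDiagonal_iff]
  exact fun l => isUnit_of_units_mul_eq_smul (hc l) (hK l)

theorem ValidGauge.exists_reshape_eq (h : ValidGauge Q E K) :
    ∃ X Y : GL (Fin r) ℂ, ∀ a,
      Matrix.of (reshape (E * (permPi (blockDiag K))⁻¹) a) = X⁻¹.val * coreSlice Q 0 a * Y.val := by
  have hunit := h.isUnit_permPi_blockDiag
  rw [permPi_blockDiag] at hunit ⊢
  obtain ⟨U, V, c, rfl, hc, hK⟩ := h
  have hX : IsUnit (V 0).valᵀ := (Matrix.isUnit_transpose _).2 (V 0).isUnit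
  have hY : IsUnit (U.val * Matrix.diagonal c⁻¹) := U.isUnit.mul
    (Matrix.isUnit_diagonal.2 (Pi.isUnit_iff.2 fun l => (inv_ne_zero (hc l)).isUnit))
  refine ⟨hX.unit⁻¹, hY.unit, fun a => ?_⟩
  rw [Matrix.mul_assoc, probeFactor_mul_inv_blockDiagonal hunit hc hK,
    reshape_unfoldAngle_mul_kronecker, inv_inv]
  rfl

end FirstCore

section SequentialSolves

variable {d r : ℕ} {n : Fin d → ℕ}

/-- The matrix whose Moore–Penrose inverse yields the core of mode `k + 1` from the cores of the
modes `0, …, k`. -/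
def solveMatrix (Q : Cores n r) (x : Index n) (k : Fin d) (G : Finset (Fin (n k))) :
    Matrix (Fin r × Fin r) G ℂ :=
  ((1 : Matrix (Fin r) (Fin r) ℂ) ⊗ₖ prefixSlices Q x k) * bracketCols (Q k) G

/-- The first `m` cores of `Q'` are those of `Q` up to the gauge `L`. As the trace is cyclic, the
product of the slices in the modes from `k` on is absorbed into `L k`. -/
structure IsPartialGauge (Q Q' : Cores n r) (x : Index n) (m : ℕ) (L : ℕ → GL (Fin r) ℂ) :
    Prop where
  val_eq : ∀ k, 2 ≤ k → (L k).val = suffixSlices Q x k * (L 0).val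
  coreSlice_eq : ∀ k : Fin d, k < m → ∀ a,
    coreSlice Q' k a = (L k)⁻¹.val * coreSlice Q k a * (L (k + 1)).val

namespace IsPartialGauge

variable {Q Q' : Cores n r} {x : Index n} {m : ℕ} {L : ℕ → GL (Fin r) ℂ}

theorem prefixSlices_eq (hL : IsPartialGauge Q Q' x m L) {j : ℕ} (hjm : j ≤ m) (hjd : j ≤ d) :
    prefixSlices Q' x j = (L 0)⁻¹.val * prefixSlices Q x j * (L j).val := by
  induction j with
  | zero => simp [prefixSlices]
  | succ j ih =>
    rw [prefixSlices, take_ofFn_prod_succ _ hjd, ← prefixSlices,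
      ih (Nat.le_of_succ_le hjm) (Nat.le_of_succ_le hjd), hL.coreSlice_eq ⟨j, hjd⟩ hjm,
      prefixSlices, prefixSlices, take_ofFn_prod_succ _ hjd]
    simp only [mul_assoc, Units.mul_inv_cancel_left]

theorem ringTensor_place_eq (hL : IsPartialGauge Q Q' x (m + 1) L) (h : m + 1 < d)
    (a : Fin (n ⟨m + 1, h⟩)) (b : Fin (n ⟨m, Nat.lt_of_succ_lt h⟩)) :
    ringTensor Q (place x ⟨m + 1, h⟩ ⟨m, Nat.lt_of_succ_lt h⟩ a b) =
      ((L (m + 1))⁻¹.val * coreSlice Q ⟨m + 1, h⟩ a * (L (m + 2)).val *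
        (prefixSlices Q' x m * coreSlice Q' ⟨m, Nat.lt_of_succ_lt h⟩ b)).trace := by
  have hconj : (L (m + 1))⁻¹.val * coreSlice Q ⟨m + 1, h⟩ a * (L (m + 2)).val *
      (prefixSlices Q' x m * coreSlice Q' ⟨m, Nat.lt_of_succ_lt h⟩ b) =
      (L (m + 1))⁻¹.val * (coreSlice Q ⟨m + 1, h⟩ a * suffixSlices Q x (m + 2) *
        (prefixSlices Q x m * coreSlice Q ⟨m, Nat.lt_of_succ_lt h⟩ b)) * (L (m + 1)).val := by
    rw [hL.val_eq (m + 2) (Nat.le_add_left 2 m),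
      hL.prefixSlices_eq (Nat.le_succ m) (Nat.lt_of_succ_lt h).le,
      hL.coreSlice_eq ⟨m, Nat.lt_of_succ_lt h⟩ (Nat.lt_succ_self m)]
    simp only [mul_assoc, Units.mul_inv_cancel_left]
  rw [hconj, Matrix.trace_units_conj', Matrix.trace_mul_comm, ringTensor_place_succ]
  simp only [mul_assoc]

theorem update (hL : IsPartialGauge Q Q' x (m + 1) L) (h : m + 1 < d)
    {A : Fin (n ⟨m + 1, h⟩) → Fin r → Fin r → ℂ}
    (hA : ∀ a, Matrix.of (A a) =
      (L (m + 1))⁻¹.val * coreSlice Q ⟨m + 1, h⟩ a * (L (m + 2)).val) :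
    IsPartialGauge Q (Function.update Q' ⟨m + 1, h⟩ A) x (m + 2) L where
  val_eq := hL.val_eq
  coreSlice_eq k hk a := by
    rcases eq_or_ne k ⟨m + 1, h⟩ with rfl | hne
    · rw [coreSlice, Function.update_self, hA]
    · have hlt : k.1 < m + 1 := lt_of_le_of_ne (Nat.lt_succ_iff.1 hk) fun h' => hne (Fin.ext h')
      rw [coreSlice, Function.update_of_ne hne, ← coreSlice, hL.coreSlice_eq k hlt]

theorem exists_mul_solveMatrix_eq_one [NeZero d] (hL : IsPartialGauge Q Q' x m L)
    (hQ : IsGeneric Q) {k : Fin d} (hk : k < m) {G : Finset (Fin (n k))} (hG : G.card = r ^ 2) :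
    ∃ W : Matrix G (Fin r × Fin r) ℂ, W * solveMatrix Q' x k G = 1 := by
  have hprefix : IsUnit (prefixSlices Q' x k * (L k)⁻¹.val) := by
    rw [hL.prefixSlices_eq hk.le k.2.le, Units.mul_inv_cancel_right]
    exact (L 0)⁻¹.isUnit.mul (isUnit_prefixSlices hQ.isUnit_coreSlice x k)
  have hright : IsUnit (L (k + 1)).valᵀ := (Matrix.isUnit_transpose _).2 (L (k + 1)).isUnit
  obtain ⟨W, hW⟩ := hQ.exists_mul_kronecker_mul_bracketCols_eq_one hG hright hprefix
  refine ⟨W, ?_⟩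
  rw [solveMatrix, bracketCols_eq_kronecker_mul (hL.coreSlice_eq k hk) G,
    ← Matrix.mul_assoc (_ ⊗ₖ _), ← Matrix.mul_kronecker_mul, Matrix.one_mul]
  exact hW

variable [NeZero d] {P : Choice n}

theorem reshape_obsSlice_mul (hL : IsPartialGauge Q Q' P.γ (m + 1) L) (hQ : IsGeneric Q)
    (h : m + 1 < d) (hG : (P.G ⟨m, Nat.lt_of_succ_lt h⟩).card = r ^ 2)
    {Z : Matrix (P.G ⟨m, Nat.lt_of_succ_lt h⟩) (Fin r × Fin r) ℂ}
    (hZ : IsMoorePenrose (solveMatrix Q' P.γ ⟨m, Nat.lt_of_succ_lt h⟩ (P.G _)) Z)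
    (a : Fin (n ⟨m + 1, h⟩)) :
    Matrix.of (reshape (obsSlice (observations P Q) P.γ ⟨m + 1, h⟩ ⟨m, Nat.lt_of_succ_lt h⟩
      (P.G ⟨m, Nat.lt_of_succ_lt h⟩) * Z) a) =
      (L (m + 1))⁻¹.val * coreSlice Q ⟨m + 1, h⟩ a * (L (m + 2)).val := by
  let A : Fin (n ⟨m + 1, h⟩) → Fin r → Fin r → ℂ := fun a =>
    Matrix.of.symm ((L (m + 1))⁻¹.val * coreSlice Q ⟨m + 1, h⟩ a * (L (m + 2)).val)
  have hobs : obsSlice (observations P Q) P.γ ⟨m + 1, h⟩ ⟨m, Nat.lt_of_succ_lt h⟩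
      (P.G ⟨m, Nat.lt_of_succ_lt h⟩) =
      unfoldAngle A * solveMatrix Q' P.γ ⟨m, Nat.lt_of_succ_lt h⟩ (P.G _) := by
    ext a b
    rw [obsSlice_observations_apply (slicePositions_succ_subset P h), hL.ringTensor_place_eq h,
      solveMatrix, unfoldAngle_mul_kronecker_mul_bracketCols]
    rfl
  obtain ⟨W, hW⟩ := hL.exists_mul_solveMatrix_eq_one hQ (Nat.lt_succ_self m) hG
  have hright := (Matrix.mul_eq_one_comm_of_card_eq _ _ _ (by simp [hG, sq])).1 (hZ.mul_eq_one hW)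
  rw [hobs, Matrix.mul_assoc, hright, Matrix.mul_one]
  rfl

theorem gaugeEquiv (hL : IsPartialGauge Q Q' x d L) (hd : 2 ≤ d) : GaugeEquiv Q Q' := by
  have hcyclic : L d = L 0 := by
    refine Units.ext ?_
    rw [hL.val_eq d hd, suffixSlices, List.drop_of_length_le (by simp), List.prod_nil, one_mul]
  have hnext (k : Fin d) : L (k + 1 : Fin d) = L (k.1 + 1) := by
    rw [Fin.val_add, Fin.val_one', Nat.mod_eq_of_lt (show 1 < d from hd)]
    rcases (Nat.succ_le_of_lt k.2).lt_or_eq with hk | hk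
    · rw [Nat.mod_eq_of_lt hk]
    · rw [show k.1 + 1 = d from hk, Nat.mod_self, hcyclic]
  exact ⟨fun k => L k, fun k a => (hL.coreSlice_eq k k.2 a).trans (by rw [← hnext])⟩

end IsPartialGauge

theorem exists_isPartialGauge_one [NeZero d] {Q : Cores n r} (hQ : IsGeneric Q) (x : Index n)
    {A : Fin (n 0) → Fin r → Fin r → ℂ} {X Y : GL (Fin r) ℂ}
    (hA : ∀ a, Matrix.of (A a) = X⁻¹.val * coreSlice Q 0 a * Y.val) :
    ∃ L, IsPartialGauge Q (Function.update (0 : Cores n r) 0 A) x 1 L := by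
  refine ⟨fun
    | 0 => X
    | 1 => Y
    | k + 2 => (isUnit_suffixSlices hQ.isUnit_coreSlice x (k + 2)).unit * X, ?_, ?_⟩
  · rintro (_ | _ | k) hk
    · simp at hk
    · simp at hk
    · rfl
  · intro k hk a
    obtain rfl : k = 0 := Fin.ext (Nat.lt_one_iff.1 hk)
    rw [coreSlice, Function.update_self, hA]
    rfl

end SequentialSolves

section Runs

variable {d r : ℕ} [NeZero d] {n : Fin d → ℕ} {P : Choice n} {Q : Cores n r} {N : ℕ}

theorem IsGeneric.validEigen (hQ : IsGeneric Q) (hd : 2 ≤ d) (hP : P.Admissible r)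
    {X : Matrix P.S (Fin (n 0)) ℂ} {X' : Matrix P.S' (Fin (n 0)) ℂ}
    {E E' : Matrix (Fin (n 0)) (Fin r × Fin r) ℂ}
    (hX : IsMoorePenrose (obsSlice (observations P Q) P.β 0 (lastMode d) P.S) X)
    (hX' : IsMoorePenrose (obsSlice (observations P Q) P.β' 0 (lastMode d) P.S') X')
    (hE : IsEigenbasis (obsSlice (observations P Q) P.α 0 (lastMode d) P.S * X) E)
    (hE' : IsEigenbasis (obsSlice (observations P Q) P.α' 0 (lastMode d) P.S' * X') E') :
    ValidEigen Q E E' := by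
  obtain ⟨hα, hβ, hα', hβ'⟩ := probe_slicePositions_subset P
  obtain ⟨_, U, V, hU, hEV⟩ :=
    hQ.exists_eq_unfoldAngle_mul_probeFactor hd (hP.sq_le 0) hP.1 hα hβ hX hE
  obtain ⟨_, U', V', hU', hEV'⟩ :=
    hQ.exists_eq_unfoldAngle_mul_probeFactor hd (hP.sq_le 0) hP.2.1 hα' hβ' hX' hE'
  exact ⟨U, U', V, V', hEV, hEV',
    (hQ.transversalPair_sliceQuot hP.probesDiffer).inv_mul_apply_ne_zero hU hU'⟩

variable [NeZero r]

/-- The invariant of the runs: `ValidState Q γ N s` says what the state `s`, reached after `N`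
steps, knows about the cores `Q`. -/
def ValidState (Q : Cores n r) (γ : Index n) (N : ℕ) : State n r → Prop
  | .start => N = 0
  | .eigen E E' => N = 1 ∧ ValidEigen Q E E'
  | .blocks E F => N = 2 ∧ ValidBlocks Q E F
  | .gauge E K => N = 3 ∧ ValidGauge Q E K
  | .cores m Q' => N = m + 3 ∧ 1 ≤ m ∧ m ≤ d ∧ ∃ L, IsPartialGauge Q Q' γ m L

theorem IsGeneric.exists_step_start (hQ : IsGeneric Q) (hd : 2 ≤ d) (hP : P.Admissible r) :
    ∃ t : State n r, Step P (observations P Q) .start t := by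
  obtain ⟨hα, hβ, hα', hβ'⟩ := probe_slicePositions_subset P
  obtain ⟨_, _, _, _, hU, hU', -⟩ := hQ.transversalPair_sliceQuot hP.probesDiffer
  obtain ⟨X, E, hX, hE⟩ := hQ.exists_isEigenbasis hd (hP.sq_le 0) hP.1 hα hβ hU
  obtain ⟨X', E', hX', hE'⟩ := hQ.exists_isEigenbasis hd (hP.sq_le 0) hP.2.1 hα' hβ' hU'
  exact ⟨_, .probes X X' E E' hX hX' hE hE'⟩

namespace ValidState

variable {s t : State n r}

theorem step (hs : ValidState Q P.γ N s) (hQ : IsGeneric Q) (hd : 2 ≤ d) (hP : P.Admissible r)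
    (hst : Step P (observations P Q) s t) : ValidState Q P.γ (N + 1) t := by
  cases hst with
  | probes X X' E E' hX hX' hE hE' =>
    exact ⟨congrArg (· + 1) hs, hQ.validEigen hd hP hX hX' hE hE'⟩
  | compare E E' Y hY =>
    obtain ⟨W, hW⟩ := hs.2.exists_mul_eq_one hQ (hP.sq_le 0)
    exact ⟨congrArg (· + 1) hs.1, hs.2.validBlocks (hY.mul_eq_one hW)⟩
  | fixGauge E F _ => exact ⟨congrArg (· + 1) hs.1, hs.2.validGauge⟩
  | firstCore E K _ =>
    obtain ⟨X, Y, hXY⟩ := hs.2.exists_reshape_eq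
    exact ⟨congrArg (· + 1) hs.1, le_rfl, NeZero.one_le, exists_isPartialGauge_one hQ P.γ hXY⟩
  | nextCore m h Q' Z hZ =>
    obtain ⟨rfl, -, -, L, hL⟩ := hs
    exact ⟨rfl, Nat.le_add_left _ _, h, L,
      hL.update h (hL.reshape_obsSlice_mul hQ h (hP.2.2.1 _) hZ)⟩

theorem of_runsTo (hQ : IsGeneric Q) (hd : 2 ≤ d) (hP : P.Admissible r)
    (h : RunsTo P (observations P Q) N s) : ValidState Q P.γ N s := by
  induction h with
  | init => exact rfl
  | next _ hst ih => exact ih.step hQ hd hP hst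

theorem le_add_three (hs : ValidState Q P.γ N s) : N ≤ d + 3 := by
  cases s <;> simp only [ValidState] at hs <;> omega

theorem exists_step (hs : ValidState Q P.γ N s) (hQ : IsGeneric Q) (hd : 2 ≤ d)
    (hP : P.Admissible r) (hN : N < d + 3) : ∃ t : State n r, Step P (observations P Q) s t := by
  cases s with
  | start => exact hQ.exists_step_start hd hP
  | eigen E E' =>
    obtain ⟨W, hW⟩ := hs.2.exists_mul_eq_one hQ (hP.sq_le 0)
    obtain ⟨Y, hY⟩ := exists_isMoorePenrose hW
    exact ⟨_, .compare E E' Y hY⟩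
  | blocks E F => exact ⟨_, .fixGauge E F fun l _ => hs.2.isUnit_subBlock l⟩
  | gauge E K => exact ⟨_, .firstCore E K hs.2.isUnit_permPi_blockDiag⟩
  | cores m Q' =>
    obtain ⟨rfl, hm, -, L, hL⟩ := hs
    obtain ⟨m, rfl⟩ := Nat.exists_eq_add_of_le' hm
    have h : m + 1 < d := Nat.lt_of_add_lt_add_right hN
    obtain ⟨W, hW⟩ := hL.exists_mul_solveMatrix_eq_one hQ (k := ⟨m, Nat.lt_of_succ_lt h⟩)
      (Nat.lt_succ_self m) (hP.2.2.1 _)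
    obtain ⟨Z, hZ⟩ := exists_isMoorePenrose hW
    exact ⟨_, .nextCore m h Q' Z hZ⟩

theorem exists_eq_cores (hs : ValidState Q P.γ (d + 3) s) (hd : 2 ≤ d) :
    ∃ Q', s = .cores d Q' ∧ GaugeEquiv Q Q' := by
  cases s with
  | cores m Q' =>
    obtain ⟨hm, -, -, L, hL⟩ := hs
    obtain rfl : d = m := Nat.add_right_cancel hm
    exact ⟨Q', rfl, hL.gaugeEquiv hd⟩
  | _ => simp only [ValidState] at hs; omega

end ValidState

end Runs

section Counting

variable {d r : ℕ} {n : Fin d → ℕ}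

theorem card_slicePositions_le (x : Index n) (i j : Fin d) (S : Finset (Fin (n j))) :
    (slicePositions x i j S).card ≤ n i * S.card :=
  Finset.card_image_le.trans (by simp)

variable [NeZero d]

theorem Choice.Admissible.card_Δ_le {P : Choice n} (hP : P.Admissible r) :
    P.Δ.card ≤ 5 * (r ^ 2 * ∑ k, n k) := by
  have hprobe (x : Index n) {S : Finset (Fin (n (lastMode d)))} (hS : S.card = r ^ 2) :
      (slicePositions x 0 (lastMode d) S).card ≤ r ^ 2 * ∑ k, n k := by
    refine (card_slicePositions_le _ _ _ _).trans ?_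
    rw [hS, mul_comm]
    gcongr
    exact Finset.single_le_sum (fun _ _ => Nat.zero_le _) (Finset.mem_univ 0)
  have hsolves : (Finset.univ.biUnion fun k : Fin d =>
      slicePositions P.γ (k + 1) k (P.G k)).card ≤ r ^ 2 * ∑ k, n k := by
    refine Finset.card_biUnion_le.trans ?_
    rw [← Equiv.sum_comp (Equiv.addRight (1 : Fin d)) n, Finset.mul_sum]
    gcongr with k
    rw [mul_comm, ← hP.2.2.1 k]
    exact card_slicePositions_le _ _ _ _
  grw [Choice.Δ, Finset.card_union_le, Finset.card_union_le, Finset.card_union_le,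
    Finset.card_union_le, hprobe _ hP.1, hprobe _ hP.1, hprobe _ hP.2.1, hprobe _ hP.2.1, hsolves]
  exact le_of_eq (by ring)

theorem exists_isMid (hd : 3 ≤ d) : ∃ m : Fin d, IsMid m := by
  refine ⟨⟨1, by omega⟩, ?_, ?_⟩
  · simp [Fin.ext_iff]
  · simp only [ne_eq, lastMode, Fin.ext_iff]
    omega

theorem isLastDiff_update {m : Fin d} (hm : IsMid m) {x : Index n} {a : Fin (n m)} (h : x m ≠ a) :
    IsLastDiff x (Function.update x m a) m :=
  ⟨hm, by rwa [Function.update_self], fun _ _ hk => (Function.update_of_ne hk.ne' _ _).symm⟩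

theorem exists_admissible (hd : 3 ≤ d) (hr : 2 ≤ r) (hn : ∀ k, r ^ 2 ≤ n k) :
    ∃ P : Choice n, P.Admissible r := by
  obtain ⟨m, hm⟩ := exists_isMid hd
  have hcard (k : Fin d) : 2 < n k :=
    lt_of_lt_of_le (by norm_num) ((Nat.pow_le_pow_left hr 2).trans (hn k))
  have hcols (k : Fin d) : ∃ G : Finset (Fin (n k)), G.card = r ^ 2 :=
    (Finset.exists_subset_card_eq (s := Finset.univ) (by simpa using hn k)).imp fun _ => And.right
  choose G hG using hcols
  let x : Index n := fun k => ⟨0, by have := hcard k; omega⟩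
  obtain ⟨a, b, ha, hb, hab⟩ : ∃ a b : Fin (n m), x m ≠ a ∧ x m ≠ b ∧ a ≠ b :=
    ⟨⟨1, by have := hcard m; omega⟩, ⟨2, hcard m⟩, by simp [x], by simp [x], by simp⟩
  refine ⟨⟨x, Function.update x m a, x, Function.update x m b, G _, G _, x, G⟩, hG _, hG _, hG, m,
    m, isLastDiff_update hm ha, isLastDiff_update hm hb, fun _ => ⟨fun h => hab ?_, fun h => hb ?_⟩⟩
  · simpa using h.2 m hm le_rfl
  · simpa using h.1 m hm le_rfl

end Counting

end TensorRing

end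

theorem theorem1 {d r : ℕ} [NeZero d] [NeZero r] (hd : 3 ≤ d) (hr : 2 ≤ r)
    (n : Fin d → ℕ) (hn : ∀ k, r ^ 2 ≤ n k)
    (μ : Measure (Cores n r)) [IsProbabilityMeasure μ] (hμ : μ ≪ volume) :
    -- admissible index choices exist, and each needs only `O(r² ∑ n_k)` observed entries
    (∃ P : Choice n, P.Admissible r) ∧
    (∀ P : Choice n, P.Admissible r → P.Δ.card ≤ 5 * (r ^ 2 * ∑ k, n k)) ∧
    -- almost surely, for all admissible index choices and all choices of eigenbases, the algorithm
    -- does not get stuck, stops after exactly `d + 3` steps, and its output is correct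
    ∀ᵐ Q ∂μ, ∀ P : Choice n, P.Admissible r →
      (∀ (N : ℕ) (s : State n r), RunsTo P (fun x : P.Δ => ringTensor Q x.1) N s →
        N ≤ d + 3 ∧
        (N < d + 3 → ∃ t : State n r, Step P (fun x : P.Δ => ringTensor Q x.1) s t)) ∧
      (∀ s : State n r, RunsTo P (fun x : P.Δ => ringTensor Q x.1) (d + 3) s →
        ∃ Q' : Cores n r, s = State.cores d Q' ∧ GaugeEquiv Q Q') := by
  have hd2 : 2 ≤ d := Nat.le_of_succ_le hd
  refine ⟨exists_admissible hd hr hn, fun P hP => hP.card_Δ_le, ?_⟩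
  filter_upwards [hμ.ae_le ae_isGeneric] with Q hQ P hP
  refine ⟨fun N s hs => ?_, fun s hs => ?_⟩
  · have hvalid := ValidState.of_runsTo hQ hd2 hP hs
    exact ⟨hvalid.le_add_three, hvalid.exists_step hQ hd2 hP⟩
  · exact (ValidState.of_runsTo hQ hd2 hP hs).exists_eq_cores hd2
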